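/- Let $k$ be a field of characteristic $0$. For $n\ge 1$ and a primitive $n$-th root of unity $\omega\in k$, the Taft algebra $T_n(\omega)$ is the Hopf algebra over $k$ generated by $x$ and $g$ with relations $gx=\omega xg$, $x^n=0$, $g^n=1$, with coproduct $\Delta(x)=x\otimes 1+g\otimes x$, $\Delta(g)=g\otimes g$, counit $\varepsilon(x)=0$, $\varepsilon(g)=1$, and antipode $S(x)=-g^{-1}x$, $S(g)=g^{-1}$. A quantum elementary abelian group over $k$ is a Hopf algebra isomorphic to an iterated tensor product over $k$ of Taft algebras $T_{n_i}(\omega_i)$. Let $A$ be a quantum elementary abelian group over $k$, let $\mathrm H^*(A,k)=\mathrm{Ext}^*_A(k,k)$ be its Hopf algebra cohomology, where $A$ acts on $k$ through $\varepsilon$, and let $\mathrm{HH}^*(A)=\mathrm{Ext}^*_{A\otimes A^{op}}(A,A)$ be its Hochschild cohomology with the Gerstenhaber bracket $[\ ,\ ]$. Let $\iota:\mathrm H^*(A,k)\to \mathrm{HH}^*(A)$ be the embedding given by the map $\mathrm{Ext}^*_A(k,k)\to\mathrm{Ext}^*_A(k,A^{ad})$ induced by the unit $k\to A$, followed by the isomorphism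 $\mathrm{Ext}^*_A(k,A^{ad})\cong \mathrm{HH}^*(A)$, where $A^{ad}$ is $A$ with the left adjoint action; on bar cochains, $\iota(f)(a_1,\dots,a_n)=\sum f(a_1',\dots,a_n')\,a_1''\cdots a_n''$, where $\Delta(a)=\sum a'\otimes a''$. Then the Lie structure on $\mathrm H^*(A,k)$ given by the Gerstenhaber bracket is abelian in positive degrees: for all $p,q\ge 1$, all $\alpha\in \mathrm H^p(A,k)$ and all $\beta\in\mathrm H^q(A,k)$, $$[\iota(\alpha),\iota(\beta)]=0\quad\text{in } \mathrm{HH}^{p+q-1}(A).$$ -/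

import Mathlib

open scoped TensorProduct

universe u

namespace QuantumElementaryAbelian

/-! ### Taft algebras as Hopf algebras -/

section Taft

/-- The two generators of a Taft algebra. -/
inductive TaftGen : Type
  | x
  | g

variable {k : Type u} [Field k]

/-- The defining relations `g x = ω x g`, `x ^ n = 0`, `g ^ n = 1` of a Taft algebra. -/
inductive TaftRel (n : ℕ) (ω : k) : FreeAlgebra k TaftGen → FreeAlgebra k TaftGen → Prop
  | skew : TaftRel n ω (FreeAlgebra.ι k .g * FreeAlgebra.ι k .x)
      (ω • (FreeAlgebra.ι k .x * FreeAlgebra.ι k .g))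
  | nilp : TaftRel n ω (FreeAlgebra.ι k .x ^ n) 0
  | tors : TaftRel n ω (FreeAlgebra.ι k .g ^ n) 1

/-- The Taft algebra `k⟨x, g | g x = ω x g, x ^ n = 0, g ^ n = 1⟩`. -/
def Taft (n : ℕ) (ω : k) : Type u := RingQuot (TaftRel n ω)

namespace Taft

noncomputable instance (n : ℕ) (ω : k) : Ring (Taft n ω) :=
  inferInstanceAs (Ring (RingQuot (TaftRel n ω)))

noncomputable instance (n : ℕ) (ω : k) : Algebra k (Taft n ω) :=
  inferInstanceAs (Algebra k (RingQuot (TaftRel n ω)))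

/-- The quotient map from the free algebra. -/
noncomputable def mk (n : ℕ) (ω : k) : FreeAlgebra k TaftGen →ₐ[k] Taft n ω :=
  RingQuot.mkAlgHom k (TaftRel n ω)

theorem mk_rel (n : ℕ) (ω : k) {a b : FreeAlgebra k TaftGen} (h : TaftRel n ω a b) :
    mk n ω a = mk n ω b := RingQuot.mkAlgHom_rel k h

/-- The class of a generator. -/
noncomputable def gen (n : ℕ) (ω : k) (t : TaftGen) : Taft n ω :=
  mk n ω (FreeAlgebra.ι k t)

/-- The nilpotent generator. -/
noncomputable abbrev x (n : ℕ) (ω : k) : Taft n ω := gen n ω .x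

/-- The group-like generator. -/
noncomputable abbrev g (n : ℕ) (ω : k) : Taft n ω := gen n ω .g

variable (n : ℕ) (ω : k)

theorem g_mul_x : g n ω * x n ω = ω • (x n ω * g n ω) := by
  have := mk_rel n ω TaftRel.skew
  simp only [map_mul, map_smul] at this
  exact this

theorem x_pow : x n ω ^ n = 0 := by
  have := mk_rel n ω TaftRel.nilp
  simp only [map_pow, map_zero] at this
  exact this

theorem g_pow : g n ω ^ n = 1 := by
  have := mk_rel n ω TaftRel.tors
  simp only [map_pow, map_one] at this
  exact this

variable {n ω}

/-- The universal property of the Taft algebra. -/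
noncomputable def lift {B : Type*} [Semiring B] [Algebra k B] (X G : B)
    (h1 : G * X = ω • (X * G)) (h2 : X ^ n = 0) (h3 : G ^ n = 1) : Taft n ω →ₐ[k] B :=
  RingQuot.liftAlgHom k ⟨FreeAlgebra.lift k (fun t => TaftGen.casesOn t X G), by
    intro a b h
    cases h <;> simp [h1, h2, h3]⟩

theorem lift_x {B : Type*} [Semiring B] [Algebra k B] (X G : B)
    (h1 : G * X = ω • (X * G)) (h2 : X ^ n = 0) (h3 : G ^ n = 1) :
    lift X G h1 h2 h3 (x n ω) = X := by
  simp only [lift, gen, mk]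
  erw [RingQuot.liftAlgHom_mkAlgHom_apply]
  simp

theorem lift_g {B : Type*} [Semiring B] [Algebra k B] (X G : B)
    (h1 : G * X = ω • (X * G)) (h2 : X ^ n = 0) (h3 : G ^ n = 1) :
    lift X G h1 h2 h3 (g n ω) = G := by
  simp only [lift, gen, mk]
  erw [RingQuot.liftAlgHom_mkAlgHom_apply]
  simp

theorem algHom_ext {B : Type*} [Semiring B] [Algebra k B] {f f' : Taft n ω →ₐ[k] B}
    (hx : f (x n ω) = f' (x n ω)) (hg : f (g n ω) = f' (g n ω)) : f = f' := by
  refine RingQuot.ringQuot_ext' (S := k) (s := TaftRel n ω) f f' ?_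
  ext t
  cases t
  · exact hx
  · exact hg

theorem induction {P : Taft n ω → Prop} (halg : ∀ c : k, P (algebraMap k _ c))
    (hx : P (x n ω)) (hg : P (g n ω)) (hadd : ∀ a b, P a → P b → P (a + b))
    (hmul : ∀ a b, P a → P b → P (a * b)) (a : Taft n ω) : P a := by
  obtain ⟨a, rfl⟩ := RingQuot.mkAlgHom_surjective k (TaftRel n ω) a
  induction a using FreeAlgebra.induction with
  | grade0 c => rw [AlgHom.commutes]; exact halg c
  | grade1 t => cases t; exacts [hx, hg]
  | mul a b ha hb => rw [map_mul]; exact hmul _ _ ha hb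
  | add a b ha hb => rw [map_add]; exact hadd _ _ ha hb

/-- Gaussian binomial coefficients at `ω`. -/
def gauss (ω : k) : ℕ → ℕ → k
  | _, 0 => 1
  | 0, _ + 1 => 0
  | n + 1, i + 1 => gauss ω n i + ω ^ (i + 1) * gauss ω n (i + 1)

theorem gauss_eq_zero_of_lt (ω : k) (n : ℕ) : ∀ i : ℕ, n < i → gauss ω n i = 0 := by
  induction n with
  | zero => intro i h; cases i with
    | zero => omega
    | succ i => rfl
  | succ n ih =>
    intro i h
    cases i with
    | zero => omega
    | succ i => simp [gauss, ih i (by omega), ih (i + 1) (by omega)]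

theorem gauss_succ_mul (ω : k) (n : ℕ) : ∀ i : ℕ,
    (1 - ω ^ (i + 1)) * gauss ω (n + 1) (i + 1) = (1 - ω ^ (n + 1)) * gauss ω n i := by
  induction n with
  | zero => intro i; cases i <;> simp [gauss]
  | succ n ih =>
    intro i
    cases i with
    | zero =>
      have h := ih 0
      have e1 : gauss ω (n + 1 + 1) (0 + 1) =
        gauss ω (n + 1) 0 + ω ^ (0 + 1) * gauss ω (n + 1) (0 + 1) := rfl
      have e0 : ∀ m, gauss ω m 0 = 1 := by intro m; cases m <;> rfl
      rw [e1]
      rw [e0] at h ⊢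
      linear_combination ω * h
    | succ i =>
      have h1 := ih (i + 1)
      have h2 := ih i
      have e1 : gauss ω (n + 1 + 1) (i + 1 + 1) =
        gauss ω (n + 1) (i + 1) + ω ^ (i + 1 + 1) * gauss ω (n + 1) (i + 1 + 1) := rfl
      have e2 : gauss ω (n + 1) (i + 1) =
        gauss ω n i + ω ^ (i + 1) * gauss ω n (i + 1) := rfl
      linear_combination (1 - ω ^ (i + 2)) * e1 + ω ^ (i + 2) * h1 + ω * h2 -
        ω * (1 - ω ^ (n + 1)) * e2

theorem add_pow_skew {B : Type*} [Ring B] [Algebra k B] (ω : k) (a b : B)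
    (h : b * a = ω • (a * b)) (n : ℕ) :
    (a + b) ^ n = ∑ i ∈ Finset.range (n + 1), gauss ω n i • (a ^ i * b ^ (n - i)) := by
  have hb : ∀ i : ℕ, b * a ^ i = ω ^ i • (a ^ i * b) := by
    intro i
    induction i with
    | zero => simp
    | succ i ih =>
      rw [pow_succ, ← mul_assoc, ih, smul_mul_assoc, mul_assoc, h, mul_smul_comm, smul_smul,
        ← mul_assoc, ← pow_succ, ← pow_succ]
  have e0 : ∀ m, gauss ω m 0 = 1 := by intro m; cases m <;> rfl
  induction n with
  | zero => simp [e0]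
  | succ n ih =>
    rw [pow_succ', ih, add_mul, Finset.sum_range_succ' _ (n + 1)]
    have e1 : b * ∑ i ∈ Finset.range (n + 1), gauss ω n i • (a ^ i * b ^ (n - i)) =
        ∑ i ∈ Finset.range (n + 1 + 1), (ω ^ i * gauss ω n i) • (a ^ i * b ^ (n + 1 - i)) := by
      rw [Finset.sum_range_succ _ (n + 1), gauss_eq_zero_of_lt ω n (n + 1) (by omega), mul_zero,
        zero_smul, add_zero, Finset.mul_sum]
      refine Finset.sum_congr rfl fun i hi => ?_
      have : n + 1 - i = n - i + 1 := by have := Finset.mem_range.1 hi; omega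
      rw [mul_smul_comm, ← mul_assoc, hb, smul_mul_assoc, mul_assoc, ← pow_succ', this, smul_smul,
        mul_comm]
    rw [e1, Finset.sum_range_succ' _ (n + 1), ← add_assoc, Finset.mul_sum,
      ← Finset.sum_add_distrib]
    congr 1
    · refine Finset.sum_congr rfl fun i hi => ?_
      rw [gauss, add_smul, mul_smul_comm, ← mul_assoc, ← pow_succ', Nat.add_sub_add_right]
    · simp [e0]

/-- If `ω` is a primitive `n`-th root of unity and `b a = ω a b`, then
`(a + b) ^ n = a ^ n + b ^ n`; here for nilpotent `a`, `b`. -/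
theorem add_pow_eq_zero {B : Type*} [Ring B] [Algebra k B] {n : ℕ} {ω : k} (hn : n ≠ 0)
    (hω : IsPrimitiveRoot ω n) (a b : B) (h : b * a = ω • (a * b)) (ha : a ^ n = 0)
    (hb : b ^ n = 0) : (a + b) ^ n = 0 := by
  rw [add_pow_skew ω a b h]
  refine Finset.sum_eq_zero fun i hi => ?_
  have hi := Finset.mem_range.1 hi
  rcases Nat.eq_zero_or_pos i with rfl | hi0
  · simp [hb]
  rcases Nat.eq_or_lt_of_le (Nat.le_of_lt_succ hi) with rfl | hin
  · simp [ha]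
  obtain ⟨n, rfl⟩ := Nat.exists_eq_succ_of_ne_zero hn
  obtain ⟨i, rfl⟩ := Nat.exists_eq_succ_of_ne_zero hi0.ne'
  have h0 := gauss_succ_mul ω n i
  have h1 : ω ^ (n + 1) = 1 := hω.pow_eq_one
  rw [h1, sub_self, zero_mul] at h0
  have h2 : 1 - ω ^ (i + 1) ≠ 0 :=
    sub_ne_zero.2 (fun h => hω.pow_ne_one_of_pos_of_lt (by omega) hin h.symm)
  have h3 : gauss ω (n + 1) (i + 1) = 0 := (mul_eq_zero.1 h0).resolve_left h2
  simp only [Nat.succ_eq_add_one]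
  rw [h3, zero_smul]

theorem skew_mul_pow {B : Type*} [Ring B] [Algebra k B] {ω : k} (a b : B)
    (h : b * a = ω • (a * b)) (n : ℕ) : ∃ c : k, (b * a) ^ n = c • (a ^ n * b ^ n) := by
  have hb : ∀ i : ℕ, b * a ^ i = ω ^ i • (a ^ i * b) := by
    intro i
    induction i with
    | zero => simp
    | succ i ih =>
      rw [pow_succ, ← mul_assoc, ih, smul_mul_assoc, mul_assoc, h, mul_smul_comm, smul_smul,
        ← mul_assoc, ← pow_succ, ← pow_succ]
  induction n with
  | zero => exact ⟨1, by simp⟩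
  | succ n ih =>
    obtain ⟨c, hc⟩ := ih
    refine ⟨c * (ω * ω ^ n), ?_⟩
    rw [pow_succ', hc, h, mul_smul_comm, smul_mul_assoc, mul_assoc, ← mul_assoc b, hb,
      smul_mul_assoc, mul_smul_comm, mul_assoc, ← pow_succ', ← mul_assoc, ← pow_succ', smul_smul,
      smul_smul]
    congr 1
    ring

section Unit

variable [NeZero n]

theorem g_mul_g_inv : g n ω * g n ω ^ (n - 1) = 1 := by
  rw [← pow_succ', Nat.sub_add_cancel (NeZero.one_le), g_pow]

theorem g_inv_mul_g : g n ω ^ (n - 1) * g n ω = 1 := by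
  rw [← pow_succ, Nat.sub_add_cancel (NeZero.one_le), g_pow]

theorem x_mul_g_inv : x n ω * g n ω ^ (n - 1) = ω • (g n ω ^ (n - 1) * x n ω) := by
  calc x n ω * g n ω ^ (n - 1)
      = g n ω ^ (n - 1) * (g n ω * x n ω) * g n ω ^ (n - 1) := by
        rw [← mul_assoc, g_inv_mul_g, one_mul]
    _ = ω • (g n ω ^ (n - 1) * x n ω) := by
        rw [g_mul_x, mul_smul_comm, smul_mul_assoc, mul_assoc, mul_assoc, g_mul_g_inv, mul_one]

/-- The counit, `ε x = 0` and `ε g = 1`. -/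
noncomputable def counitHom : Taft n ω →ₐ[k] k :=
  lift 0 1 (by simp) (zero_pow (NeZero.ne n)) (one_pow n)

theorem counitHom_x : counitHom (x n ω) = 0 := lift_x ..

theorem counitHom_g : counitHom (g n ω) = 1 := lift_g ..

end Unit

section Hopf

variable [NeZero n] [hω : Fact (IsPrimitiveRoot ω n)]

/-- The coproduct, `Δ x = x ⊗ 1 + g ⊗ x` and `Δ g = g ⊗ g`. -/
noncomputable def comulHom : Taft n ω →ₐ[k] Taft n ω ⊗[k] Taft n ω :=
  lift (x n ω ⊗ₜ 1 + g n ω ⊗ₜ x n ω) (g n ω ⊗ₜ g n ω)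
    (by
      simp only [mul_add, add_mul, Algebra.TensorProduct.tmul_mul_tmul, g_mul_x, mul_one, one_mul,
        smul_add, TensorProduct.smul_tmul', TensorProduct.tmul_smul])
    (by
      refine add_pow_eq_zero (NeZero.ne n) hω.out _ _ ?_ ?_ ?_
      · simp [Algebra.TensorProduct.tmul_mul_tmul, g_mul_x, TensorProduct.smul_tmul']
      · simp [Algebra.TensorProduct.tmul_pow, x_pow]
      · simp [Algebra.TensorProduct.tmul_pow, x_pow])
    (by simp [Algebra.TensorProduct.tmul_pow, g_pow, Algebra.TensorProduct.one_def])

theorem comulHom_x : comulHom (x n ω) = x n ω ⊗ₜ[k] 1 + g n ω ⊗ₜ x n ω := lift_x ..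

theorem comulHom_g : comulHom (g n ω) = g n ω ⊗ₜ[k] g n ω := lift_g ..

noncomputable instance : Bialgebra k (Taft n ω) :=
  Bialgebra.ofAlgHom comulHom counitHom
    (by
      refine algHom_ext ?_ ?_
      · simp [comulHom_x, comulHom_g, TensorProduct.add_tmul, TensorProduct.tmul_add,
          Algebra.TensorProduct.one_def, add_assoc]
      · simp [comulHom_g])
    (by
      refine algHom_ext ?_ ?_
      · simp [comulHom_x, counitHom_x, counitHom_g]
      · simp [comulHom_g, counitHom_g])
    (by
      refine algHom_ext ?_ ?_
      · simp [comulHom_x, counitHom_x]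
      · simp [comulHom_g, counitHom_g])

theorem comul_x : Coalgebra.comul (R := k) (x n ω) = x n ω ⊗ₜ[k] 1 + g n ω ⊗ₜ x n ω :=
  comulHom_x

theorem comul_g : Coalgebra.comul (R := k) (g n ω) = g n ω ⊗ₜ[k] g n ω := comulHom_g

theorem counit_x : Coalgebra.counit (R := k) (x n ω) = 0 := counitHom_x

theorem counit_g : Coalgebra.counit (R := k) (g n ω) = 1 := counitHom_g

open MulOpposite in
/-- The antipode as a homomorphism to the opposite algebra, `S x = - g⁻¹ x` and `S g = g⁻¹`. -/
noncomputable def antipodeHom : Taft n ω →ₐ[k] (Taft n ω)ᵐᵒᵖ :=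
  lift (op (-(g n ω ^ (n - 1) * x n ω))) (op (g n ω ^ (n - 1)))
    (by
      rw [← op_mul, ← op_mul, ← op_smul]
      congr 1
      rw [neg_mul, mul_neg, mul_assoc, x_mul_g_inv, mul_smul_comm, smul_neg])
    (by
      have hω0 : ω ≠ 0 := hω.out.ne_zero (NeZero.ne n)
      rw [← op_pow, neg_pow]
      obtain ⟨c, hc⟩ := skew_mul_pow (ω := ω⁻¹) (x n ω) (g n ω ^ (n - 1)) (by
        rw [x_mul_g_inv, smul_smul, inv_mul_cancel₀ hω0, one_smul]) n
      rw [hc, x_pow]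
      simp)
    (by rw [← op_pow, ← pow_mul, mul_comm, pow_mul, g_pow, one_pow, op_one])

/-- The antipode. -/
noncomputable def antipodeMap : Taft n ω →ₗ[k] Taft n ω :=
  (MulOpposite.opLinearEquiv k).symm.toLinearMap ∘ₗ antipodeHom.toLinearMap

theorem antipodeMap_mul (a b : Taft n ω) :
    antipodeMap (a * b) = antipodeMap b * antipodeMap a := by
  simp [antipodeMap]

theorem antipodeMap_x : antipodeMap (x n ω) = -(g n ω ^ (n - 1) * x n ω) := by
  simp only [antipodeMap, antipodeHom, LinearMap.comp_apply, AlgHom.toLinearMap_apply]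
  rw [lift_x]
  rfl

theorem antipodeMap_g : antipodeMap (g n ω) = g n ω ^ (n - 1) := by
  simp only [antipodeMap, antipodeHom, LinearMap.comp_apply, AlgHom.toLinearMap_apply]
  rw [lift_g]
  rfl

theorem antipodeMap_algebraMap (c : k) :
    antipodeMap (algebraMap k (Taft n ω) c) = algebraMap k (Taft n ω) c := by
  simp [antipodeMap]

theorem antipode_left_tmul (u : Taft n ω ⊗[k] Taft n ω) (c d : Taft n ω) :
    LinearMap.mul' k _ (antipodeMap.rTensor _ (u * c ⊗ₜ d)) =
      antipodeMap c * LinearMap.mul' k _ (antipodeMap.rTensor _ u) * d := by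
  induction u with
  | zero => simp
  | add u v hu hv => simp only [add_mul, mul_add, map_add, hu, hv]
  | tmul p q =>
    simp only [Algebra.TensorProduct.tmul_mul_tmul, LinearMap.rTensor_tmul, LinearMap.mul'_apply,
      antipodeMap_mul, mul_assoc]

theorem antipode_right_tmul (u : Taft n ω ⊗[k] Taft n ω) (c d : Taft n ω) :
    LinearMap.mul' k _ (antipodeMap.lTensor _ (c ⊗ₜ d * u)) =
      c * LinearMap.mul' k _ (antipodeMap.lTensor _ u) * antipodeMap d := by
  induction u with
  | zero => simp
  | add u v hu hv => simp only [add_mul, mul_add, map_add, hu, hv]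
  | tmul p q =>
    simp only [Algebra.TensorProduct.tmul_mul_tmul, LinearMap.lTensor_tmul, LinearMap.mul'_apply,
      antipodeMap_mul, mul_assoc]

theorem antipode_left (a : Taft n ω) :
    LinearMap.mul' k _ (antipodeMap.rTensor _ (Coalgebra.comul (R := k) a)) =
      algebraMap k _ (Coalgebra.counit (R := k) a) := by
  induction a using induction with
  | halg c =>
    rw [Bialgebra.comul_algebraMap, Bialgebra.counit_algebraMap,
      Algebra.TensorProduct.algebraMap_apply]
    simp [antipodeMap_algebraMap]
  | hx => simp [comul_x, counit_x, antipodeMap_x, antipodeMap_g]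
  | hg => simp [comul_g, counit_g, antipodeMap_g, g_inv_mul_g]
  | hadd a b ha hb => simp only [map_add, ha, hb]
  | hmul a b ha hb =>
    rw [Bialgebra.comul_mul, Bialgebra.counit_mul, map_mul (algebraMap k (Taft n ω)), ← hb]
    generalize Coalgebra.comul (R := k) b = v
    induction v with
    | zero => simp
    | add u v hu hv => simp only [mul_add, map_add, hu, hv]
    | tmul c d =>
      rw [antipode_left_tmul, ha, LinearMap.rTensor_tmul, LinearMap.mul'_apply,
        ← Algebra.commutes, mul_assoc]

theorem antipode_right (a : Taft n ω) :
    LinearMap.mul' k _ (antipodeMap.lTensor _ (Coalgebra.comul (R := k) a)) =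
      algebraMap k _ (Coalgebra.counit (R := k) a) := by
  induction a using induction with
  | halg c =>
    rw [Bialgebra.comul_algebraMap, Bialgebra.counit_algebraMap,
      Algebra.TensorProduct.algebraMap_apply]
    have h1 : antipodeMap (1 : Taft n ω) = 1 := by
      simpa using antipodeMap_algebraMap (n := n) (ω := ω) 1
    simp [h1]
  | hx =>
    have h1 : antipodeMap (1 : Taft n ω) = 1 := by
      simpa using antipodeMap_algebraMap (n := n) (ω := ω) 1
    simp [comul_x, counit_x, antipodeMap_x, h1, ← mul_assoc, g_mul_g_inv]
  | hg => simp [comul_g, counit_g, antipodeMap_g, g_mul_g_inv]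
  | hadd a b ha hb => simp only [map_add, ha, hb]
  | hmul a b ha hb =>
    rw [Bialgebra.comul_mul, Bialgebra.counit_mul, map_mul (algebraMap k (Taft n ω)), ← ha]
    generalize Coalgebra.comul (R := k) a = v
    induction v with
    | zero => simp
    | add u v hu hv => simp only [add_mul, map_add, hu, hv]
    | tmul c d =>
      rw [antipode_right_tmul, hb, LinearMap.lTensor_tmul, LinearMap.mul'_apply,
        mul_assoc, mul_assoc, Algebra.commutes]

/-- The Taft algebra as a Hopf algebra. -/
noncomputable instance : HopfAlgebra k (Taft n ω) where
  antipode := antipodeMap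
  mul_antipode_rTensor_comul := LinearMap.ext antipode_left
  mul_antipode_lTensor_comul := LinearMap.ext antipode_right

end Hopf

end Taft

end Taft

/-- Quantum elementary abelian groups over `k`: the Hopf algebras obtained from Taft algebras
(with arbitrary `n ≥ 1` and arbitrary primitive `n`-th roots of unity `ω ∈ k`; for `n = 1` the Taft
algebra is `k`) by taking tensor products over `k`, up to isomorphism of Hopf algebras. -/
inductive IsQuantumElementaryAbelian (k : Type u) [Field k] :
    (A : Type u) → [Ring A] → [HopfAlgebra k A] → Prop
  | taft (n : ℕ) [NeZero n] (ω : k) [Fact (IsPrimitiveRoot ω n)] :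
      IsQuantumElementaryAbelian k (Taft n ω)
  | tensor (A B : Type u) [Ring A] [HopfAlgebra k A] [Ring B] [HopfAlgebra k B] :
      IsQuantumElementaryAbelian k A → IsQuantumElementaryAbelian k B →
        IsQuantumElementaryAbelian k (A ⊗[k] B)
  | equiv (A B : Type u) [Ring A] [HopfAlgebra k A] [Ring B] [HopfAlgebra k B] (e : A ≃ₐc[k] B) :
      IsQuantumElementaryAbelian k A → IsQuantumElementaryAbelian k B

/-! ### Cochains and the Gerstenhaber bracket -/

section Cochain

set_option linter.unusedSectionVars false

variable {k : Type*} [Field k] {A : Type*} {M : Type*}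

/-- The arguments of `f ∘ᵢ g`: the list `a₀, …, aᵢ₋₁, g (aᵢ, …, aᵢ₊q₋₁), aᵢ₊q, …, aᵣ₋₁`
of length `p`, where `r = p + q - 1`. -/
def insertArgs {p q r : ℕ} (h : p + q = r + 1) (i : Fin p) (g : (Fin q → A) → A)
    (a : Fin r → A) (j : Fin p) : A :=
  if _hj : (j : ℕ) < i then a ⟨j, by omega⟩
  else if _hj' : j = i then g (fun l => a ⟨i + l, by omega⟩)
  else a ⟨j + q - 1, by omega⟩

variable [AddCommGroup A] [Module k A] [AddCommGroup M] [Module k M]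

variable (k A M) in
/-- The `n`-cochains `Hom_k (A^{⊗ n}, M)`, as `k`-multilinear maps. -/
abbrev Cochain (n : ℕ) := MultilinearMap k (fun _ : Fin n => A) M

theorem insertArgs_update {p q r : ℕ} (h : p + q = r + 1) (i : Fin p) (g : Cochain k A A q)
    (a : Fin r → A) (s : Fin r) : ∃ (j : Fin p) (φ : A →ₗ[k] A), ∀ x,
      insertArgs h i g (Function.update a s x) = Function.update (insertArgs h i g a) j (φ x) := by
  rcases lt_or_ge (s : ℕ) i with h1 | h1
  · refine ⟨⟨s, by omega⟩, LinearMap.id, fun x => ?_⟩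
    funext j
    simp only [insertArgs, Function.update_apply, Fin.ext_iff, LinearMap.id_apply]
    split_ifs <;> first | omega | rfl | skip
    congr 1
    funext l
    rw [if_neg (by omega)]
  rcases lt_or_ge (s : ℕ) (i + q) with h2 | h2
  · refine ⟨i, g.toLinearMap (fun l => a ⟨i + l, by omega⟩) ⟨s - i, by omega⟩, fun x => ?_⟩
    funext j
    simp only [insertArgs, Function.update_apply, Fin.ext_iff, MultilinearMap.toLinearMap_apply]
    split_ifs <;> first | omega | rfl | skip
    congr 1
    funext l
    simp only [Function.update_apply, Fin.ext_iff]
    split_ifs <;> first | omega | rfl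
  · refine ⟨⟨s - q + 1, by omega⟩, LinearMap.id, fun x => ?_⟩
    funext j
    simp only [insertArgs, Function.update_apply, Fin.ext_iff, LinearMap.id_apply]
    split_ifs <;> first | omega | rfl | skip
    congr 1
    funext l
    rw [if_neg (by omega)]

/-- The partial composition `f ∘ᵢ g`. -/
def partialComp {p q r : ℕ} (h : p + q = r + 1) (i : Fin p) (f : Cochain k A M p)
    (g : Cochain k A A q) : Cochain k A M r where
  toFun a := f (insertArgs h i g a)
  map_update_add' {inst} a s x y := by
    obtain rfl : inst = instDecidableEqFin r := Subsingleton.elim _ _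
    obtain ⟨j, φ, hφ⟩ := insertArgs_update h i g a s
    simp only [hφ, map_add, MultilinearMap.map_update_add]
  map_update_smul' {inst} a s c x := by
    obtain rfl : inst = instDecidableEqFin r := Subsingleton.elim _ _
    obtain ⟨j, φ, hφ⟩ := insertArgs_update h i g a s
    simp only [hφ, map_smul, MultilinearMap.map_update_smul]

@[simp]
theorem partialComp_apply {p q r : ℕ} (h : p + q = r + 1) (i : Fin p) (f : Cochain k A M p)
    (g : Cochain k A A q) (a : Fin r → A) :
    partialComp h i f g a = f (insertArgs h i g a) := rfl

theorem insertArgs_eq_update {p q r : ℕ} (h : p + q = r + 1) (i : Fin p) (g : (Fin q → A) → A)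
    (a : Fin r → A) : insertArgs h i g a =
      Function.update (insertArgs h i 0 a) i (g (fun l => a ⟨i + l, by omega⟩)) := by
  funext j
  simp only [insertArgs, Function.update_apply, Fin.ext_iff]
  split_ifs <;> first | omega | rfl

theorem partialComp_add_left {p q r : ℕ} (h : p + q = r + 1) (i : Fin p) (f f' : Cochain k A M p)
    (g : Cochain k A A q) :
    partialComp h i (f + f') g = partialComp h i f g + partialComp h i f' g := rfl

theorem partialComp_smul_left {p q r : ℕ} (h : p + q = r + 1) (i : Fin p) (c : k)
    (f : Cochain k A M p) (g : Cochain k A A q) :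
    partialComp h i (c • f) g = c • partialComp h i f g := rfl

theorem partialComp_add_right {p q r : ℕ} (h : p + q = r + 1) (i : Fin p) (f : Cochain k A M p)
    (g g' : Cochain k A A q) :
    partialComp h i f (g + g') = partialComp h i f g + partialComp h i f g' := by
  ext a
  simp only [partialComp_apply, add_apply]
  rw [insertArgs_eq_update, insertArgs_eq_update h i g, insertArgs_eq_update h i g']
  simp

theorem partialComp_smul_right {p q r : ℕ} (h : p + q = r + 1) (i : Fin p) (c : k)
    (f : Cochain k A M p) (g : Cochain k A A q) :
    partialComp h i f (c • g) = c • partialComp h i f g := by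
  ext a
  simp only [partialComp_apply, smul_apply]
  rw [insertArgs_eq_update, insertArgs_eq_update h i g]
  simp

/-- The circle product `f ∘ g = ∑ᵢ (-1)^(i (q - 1)) f ∘ᵢ g` of cochains of degrees `p` and `q`,
bilinear in `f` and `g`. The exponents are written with `q + 1` in place of `q - 1`. -/
def circ {p q r : ℕ} (h : p + q = r + 1) :
    Cochain k A A p →ₗ[k] Cochain k A A q →ₗ[k] Cochain k A A r :=
  LinearMap.mk₂ k (fun f g => ∑ i : Fin p, (-1 : k) ^ ((i : ℕ) * (q + 1)) • partialComp h i f g)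
    (fun f f' g => by
      simp only [partialComp_add_left, smul_add, Finset.sum_add_distrib])
    (fun c f g => by
      simp only [partialComp_smul_left, Finset.smul_sum, smul_comm c])
    (fun f g g' => by
      simp only [partialComp_add_right, smul_add, Finset.sum_add_distrib])
    (fun c f g => by
      simp only [partialComp_smul_right, Finset.smul_sum, smul_comm c])

theorem circ_apply {p q r : ℕ} (h : p + q = r + 1) (f : Cochain k A A p) (g : Cochain k A A q)
    (a : Fin r → A) : circ h f g a =
      ∑ i : Fin p, (-1 : k) ^ ((i : ℕ) * (q + 1)) • f (insertArgs h i g a) := by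
  change (∑ i : Fin p, (-1 : k) ^ ((i : ℕ) * (q + 1)) • partialComp h i f g) a = _
  simp

/-- The Gerstenhaber bracket `[f, g] = f ∘ g - (-1)^((p - 1) (q - 1)) g ∘ f` of cochains of degrees
`p` and `q`; it has degree `p + q - 1`. -/
def bracket {p q r : ℕ} (h : p + q = r + 1) :
    Cochain k A A p →ₗ[k] Cochain k A A q →ₗ[k] Cochain k A A r :=
  circ h - (-1 : k) ^ ((p + 1) * (q + 1)) • (circ ((add_comm q p).trans h)).flip

theorem bracket_apply {p q r : ℕ} (h : p + q = r + 1) (f : Cochain k A A p)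
    (g : Cochain k A A q) : bracket h f g =
      circ h f g - (-1 : k) ^ ((p + 1) * (q + 1)) • circ ((add_comm q p).trans h) g f := rfl

/-! ### The graded right pre-Lie identity -/

/-- Auxiliary version of `insertArgs` for sequences. -/
def insN (i q : ℕ) (G : (ℕ → A) → A) (a : ℕ → A) (j : ℕ) : A :=
  if j < i then a j else if j = i then G (fun l => a (i + l)) else a (j + q - 1)

/-- A cochain as a function of a sequence. -/
def nat {p : ℕ} (f : Cochain k A M p) (a : ℕ → A) : M := f (fun j => a j)

theorem nat_congr {p : ℕ} (f : Cochain k A M p) {a b : ℕ → A} (h : ∀ l < p, a l = b l) :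
    nat f a = nat f b := by
  simp only [nat]
  congr 1
  funext j
  exact h j j.2

theorem nat_injective {p : ℕ} {f g : Cochain k A M p} (h : nat f = nat g) : f = g := by
  ext a
  have := congrFun h (fun j => if hj : j < p then a ⟨j, hj⟩ else 0)
  simpa [nat] using this

theorem insertArgs_nat {p q r : ℕ} (h : p + q = r + 1) (i : Fin p) (g : Cochain k A A q)
    (a : ℕ → A) : insertArgs h i g (fun j : Fin r => a j) =
      fun j : Fin p => insN i q (nat g) a j := by
  funext j
  simp only [insertArgs, insN, nat, Fin.ext_iff]
  split_ifs <;> rfl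

theorem nat_circ {p q r : ℕ} (h : p + q = r + 1) (f : Cochain k A A p) (g : Cochain k A A q)
    (a : ℕ → A) : nat (circ h f g) a =
      ∑ i ∈ Finset.range p, (-1 : k) ^ (i * (q + 1)) • nat f (insN i q (nat g) a) := by
  rw [← Fin.sum_univ_eq_sum_range (fun i => (-1 : k) ^ (i * (q + 1)) • nat f (insN i q (nat g) a)),
    nat, circ_apply]
  simp only [insertArgs_nat, nat]

/-- Simultaneous insertion at two positions `i < i'`. -/
def dblN (i q : ℕ) (G : (ℕ → A) → A) (i' s : ℕ) (H : (ℕ → A) → A) (a : ℕ → A) (j : ℕ) : A :=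
  if j < i then a j else if j = i then G (fun l => a (i + l)) else if j < i' then a (j + q - 1)
  else if j = i' then H (fun l => a (i' + q - 1 + l)) else a (j + q - 1 + s - 1)

theorem insN_before {i q j s : ℕ} (hji : j < i) (G H : (ℕ → A) → A) (a : ℕ → A) :
    insN i q G (insN j s H a) = dblN j s H i q G a := by
  funext t
  simp only [insN, dblN]
  split_ifs <;> first | omega | rfl | skip
  · congr 1
    funext l
    rw [if_neg (by omega), if_neg (by omega)]
    congr 1
    omega
  · congr 1
    omega

theorem insN_after {i q i' s : ℕ} (hi : i < i') (G H : (ℕ → A) → A) (a : ℕ → A)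
    (hG : ∀ b c : ℕ → A, (∀ l < q, b l = c l) → G b = G c) :
    insN i q G (insN (i' + q - 1) s H a) = dblN i q G i' s H a := by
  funext t
  simp only [insN, dblN]
  split_ifs <;> first | omega | rfl | skip
  apply hG
  intro l hl
  rw [if_pos (by omega)]

theorem insN_inside {i q j s : ℕ} (hj : j < q) (G H : (ℕ → A) → A) (a : ℕ → A) :
    insN i q G (insN (i + j) s H a) = insN i (q + s - 1) (fun b => G (insN j s H b)) a := by
  funext t
  simp only [insN]
  split_ifs <;> first | omega | rfl | skip
  · congr 1
    funext l
    simp only [insN]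
    split_ifs <;> first | omega | rfl | skip
    · congr 1
      funext m
      rw [add_assoc]
    · congr 1
      omega
  · congr 1
    omega

theorem sum_range_triangle {M : Type*} [AddCommMonoid M] (φ : ℕ → ℕ → M) (p : ℕ) :
    ∑ i ∈ Finset.range p, ∑ e ∈ Finset.range (p - 1 - i), φ i (i + 1 + e) =
      ∑ i' ∈ Finset.range p, ∑ i ∈ Finset.range i', φ i i' := by
  induction p with
  | zero => simp
  | succ p ih =>
    rw [Finset.sum_range_succ _ p, Finset.sum_range_succ _ p, ← ih]
    simp only [Nat.add_sub_cancel, Nat.sub_self, Finset.range_zero, Finset.sum_empty, add_zero]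
    rw [← Finset.sum_add_distrib]
    refine Finset.sum_congr rfl fun i hi => ?_
    have hi := Finset.mem_range.1 hi
    obtain ⟨m, rfl⟩ : ∃ m, p = i + 1 + m := ⟨p - (i + 1), by omega⟩
    rw [show i + 1 + m - i = m + 1 by omega, show i + 1 + m - 1 - i = m by omega,
      Finset.sum_range_succ]

theorem nat_insN_linear {p i : ℕ} (hi : i < p) (f : Cochain k A A p) {ι : Type*} (s : Finset ι)
    (q : ℕ) (c : ι → k) (G : ι → (ℕ → A) → A) (a : ℕ → A) :
    nat f (insN i q (fun b => ∑ j ∈ s, c j • G j b) a) =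
      ∑ j ∈ s, c j • nat f (insN i q (G j) a) := by
  have key : ∀ G : (ℕ → A) → A, nat f (insN i q G a) =
      f.toLinearMap (fun j => insN i q 0 a j) ⟨i, hi⟩ (G (fun l => a (i + l))) := by
    intro G
    simp only [nat, MultilinearMap.toLinearMap_apply]
    congr 1
    funext j
    simp only [insN, Function.update_apply, Fin.ext_iff]
    split_ifs <;> first | omega | rfl
  simp only [key, map_sum, map_smul]

theorem nat_assoc {p q s r t u : ℕ} (h1 : p + q = r + 1) (h2 : r + s = t + 1)
    (h3 : q + s = u + 1) (h4 : p + u = t + 1)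
    (f : Cochain k A A p) (g : Cochain k A A q) (h : Cochain k A A s) (a : ℕ → A) :
    nat (circ h2 (circ h1 f g) h) a - nat (circ h4 f (circ h3 g h)) a =
      ∑ i' ∈ Finset.range p, ∑ i ∈ Finset.range i',
        ((-1 : k) ^ (i * (s + 1) + i' * (q + 1)) • nat f (dblN i s (nat h) i' q (nat g) a) +
          (-1 : k) ^ ((i' + (q + 1)) * (s + 1) + i * (q + 1)) •
            nat f (dblN i q (nat g) i' s (nat h) a)) := by
  rw [sub_eq_iff_eq_add]
  rw [nat_circ, nat_circ]
  have e3 : nat (circ h3 g h) = fun b =>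
      ∑ j ∈ Finset.range q, (-1 : k) ^ (j * (s + 1)) • nat g (insN j s (nat h) b) := by
    funext b
    exact nat_circ h3 g h b
  simp only [nat_circ, Finset.smul_sum, smul_smul]
  rw [Finset.sum_comm]
  simp only [Finset.sum_add_distrib]
  rw [← sum_range_triangle (fun i i' => (-1 : k) ^ ((i' + (q + 1)) * (s + 1) + i * (q + 1)) •
            nat f (dblN i q (nat g) i' s (nat h) a)), ← Finset.sum_add_distrib,
    ← Finset.sum_add_distrib]
  refine Finset.sum_congr rfl fun i hi => ?_
  have hi := Finset.mem_range.1 hi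
  rw [show r = i + q + (p - 1 - i) by omega, Finset.sum_range_add, Finset.sum_range_add, e3,
    nat_insN_linear hi, add_right_comm]
  congr 1
  · congr 1
    · refine Finset.sum_congr rfl fun j hj => ?_
      rw [insN_before (Finset.mem_range.1 hj), pow_add]
    · refine Finset.sum_congr rfl fun e he => ?_
      rw [← insN_after (by omega) _ _ _ (fun b c hbc => nat_congr g hbc),
        show i + 1 + e + q - 1 = i + q + e by omega, ← pow_add]
      congr 1
      rw [show (i + 1 + e + (q + 1)) * (s + 1) + i * (q + 1) =
        (i + q + e) * (s + 1) + i * (q + 1) + 2 * (s + 1) by ring, pow_add _ _ (2 * (s + 1)),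
        pow_mul]
      simp
  · rw [Finset.smul_sum]
    refine Finset.sum_congr rfl fun j hj => ?_
    have hj := Finset.mem_range.1 hj
    rw [insN_inside hj, show q + s - 1 = u by omega, ← pow_add, smul_smul, ← pow_add]
    congr 1
    rw [show i * (u + 1) = i * (q + s) by rw [h3], show (i + j) * (s + 1) + i * (q + 1) =
        i * (q + s) + j * (s + 1) + 2 * i by ring, pow_add _ _ (2 * i), pow_mul _ 2]
    simp

theorem preLie {p q s r r' t u : ℕ} (h1 : p + q = r + 1) (h2 : r + s = t + 1)
    (h3 : q + s = u + 1) (h4 : p + u = t + 1) (h5 : p + s = r' + 1) (h6 : r' + q = t + 1)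
    (h7 : s + q = u + 1)
    (f : Cochain k A A p) (g : Cochain k A A q) (h : Cochain k A A s) :
    circ h2 (circ h1 f g) h - circ h4 f (circ h3 g h) = (-1 : k) ^ ((q + 1) * (s + 1)) •
      (circ h6 (circ h5 f h) g - circ h4 f (circ h7 h g)) := by
  apply nat_injective
  funext a
  have e1 := nat_assoc h1 h2 h3 h4 f g h a
  have e2 := nat_assoc h5 h6 h7 h4 f h g a
  simp only [nat, sub_apply, smul_apply] at e1 e2 ⊢
  rw [e1, e2, Finset.smul_sum]
  refine Finset.sum_congr rfl fun i' _ => ?_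
  rw [Finset.smul_sum]
  refine Finset.sum_congr rfl fun i _ => ?_
  rw [smul_add, smul_smul, smul_smul, ← pow_add, ← pow_add, add_comm]
  have c1 : (-1 : k) ^ ((q + 1) * (s + 1) + ((i' + (s + 1)) * (q + 1) + i * (s + 1))) =
      (-1 : k) ^ (i * (s + 1) + i' * (q + 1)) := by
    rw [show (q + 1) * (s + 1) + ((i' + (s + 1)) * (q + 1) + i * (s + 1)) =
      i * (s + 1) + i' * (q + 1) + 2 * ((q + 1) * (s + 1)) by ring, pow_add _ _ (2 * _),
      pow_mul _ 2]
    simp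
  have c2 : (q + 1) * (s + 1) + (i * (q + 1) + i' * (s + 1)) =
      (i' + (q + 1)) * (s + 1) + i * (q + 1) := by ring
  rw [c1, c2, add_comm]

/-- The graded Jacobi identity
`[[f, g], h] = [f, [g, h]] + (-1)^((q - 1) (s - 1)) [[f, h], g]`. -/
theorem jacobi {p q s r r' t u : ℕ} (h1 : p + q = r + 1) (h2 : r + s = t + 1)
    (h3 : q + s = u + 1) (h4 : p + u = t + 1) (h5 : p + s = r' + 1) (h6 : r' + q = t + 1)
    (f : Cochain k A A p) (g : Cochain k A A q) (h : Cochain k A A s) :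
    bracket h2 (bracket h1 f g) h = bracket h4 f (bracket h3 g h) +
      (-1 : k) ^ ((q + 1) * (s + 1)) • bracket h6 (bracket h5 f h) g := by
  have e1 := preLie h1 h2 h3 h4 h5 h6 (by omega) f g h
  have e2 := preLie (p := q) (q := p) (s := s) (u := r') (r' := u) (t := t) (r := r)
    (by omega) (by omega) (by omega) (by omega) (by omega) (by omega) (by omega) g f h
  have e3 := preLie (p := s) (q := p) (s := q) (u := r) (r' := u) (t := t) (r := r')
    (by omega) (by omega) (by omega) (by omega) (by omega) (by omega) (by omega) h f g
  have s1 : (-1 : k) ^ ((r + 1) * (s + 1)) =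
      (-1 : k) ^ ((p + 1) * (s + 1)) * (-1 : k) ^ ((q + 1) * (s + 1)) := by
    rw [← h1, ← pow_add, show (p + 1) * (s + 1) + (q + 1) * (s + 1) =
      (p + q) * (s + 1) + 2 * (s + 1) by ring, pow_add _ _ (2 * _), pow_mul _ 2]
    simp
  have s2 : (-1 : k) ^ ((p + 1) * (u + 1)) =
      (-1 : k) ^ ((p + 1) * (q + 1)) * (-1 : k) ^ ((p + 1) * (s + 1)) := by
    rw [← h3, ← pow_add, show (p + 1) * (q + 1) + (p + 1) * (s + 1) =
      (p + 1) * (q + s) + 2 * (p + 1) by ring, pow_add _ _ (2 * _), pow_mul _ 2]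
    simp
  have s3 : (-1 : k) ^ ((r' + 1) * (q + 1)) =
      (-1 : k) ^ ((p + 1) * (q + 1)) * (-1 : k) ^ ((q + 1) * (s + 1)) := by
    rw [← h5, ← pow_add, show (p + 1) * (q + 1) + (q + 1) * (s + 1) =
      (p + s) * (q + 1) + 2 * (q + 1) by ring, pow_add _ _ (2 * _), pow_mul _ 2]
    simp
  simp only [bracket_apply, map_sub, map_smul, LinearMap.sub_apply, LinearMap.smul_apply, s1, s2,
    s3]
  have c1 := neg_one_pow_eq_or k ((p + 1) * (q + 1))
  have c2 := neg_one_pow_eq_or k ((p + 1) * (s + 1))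
  have c3 := neg_one_pow_eq_or k ((q + 1) * (s + 1))
  generalize (-1 : k) ^ ((p + 1) * (q + 1)) = x at *
  generalize (-1 : k) ^ ((p + 1) * (s + 1)) = y at *
  generalize (-1 : k) ^ ((q + 1) * (s + 1)) = z at *
  rcases c1 with c1 | c1 <;> rcases c2 with c2 | c2 <;> rcases c3 with c3 | c3 <;>
  linear_combination (norm := (simp only [c1, c2, c3]; module)) e1 - x • e2 + (y * z) • e3

end Cochain

/-! ### Hochschild differentials and cohomology -/

section Cohomology

variable {k : Type*} [Field k] {A : Type*} [Ring A] [Algebra k A]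
  {M : Type*} [AddCommGroup M] [Module k M]

variable (k A) in
/-- The multiplication of `A` as a `2`-cochain. -/
def mulCochain : Cochain k A A 2 := MultilinearMap.mkPiAlgebraFin k 2 A

@[simp]
theorem mulCochain_apply (a : Fin 2 → A) : mulCochain k A a = a 0 * a 1 := by
  simp [mulCochain, MultilinearMap.mkPiAlgebraFin_apply]

theorem deg_mul (n : ℕ) : n + 2 = (n + 1) + 1 := rfl

/-- The cochain `(a₀, …, aₙ) ↦ a₀ · f (a₁, …, aₙ)`. -/
def leftTerm {n : ℕ} (L : A →ₗ[k] M →ₗ[k] M) (f : Cochain k A M n) : Cochain k A M (n + 1) where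
  toFun a := L (a 0) (f (Fin.tail a))
  map_update_add' {inst} a s x y := by
    obtain rfl : inst = instDecidableEqFin (n + 1) := Subsingleton.elim _ _
    refine Fin.cases ?_ (fun s => ?_) s <;> simp [(Fin.succ_ne_zero _).symm]
  map_update_smul' {inst} a s c x := by
    obtain rfl : inst = instDecidableEqFin (n + 1) := Subsingleton.elim _ _
    refine Fin.cases ?_ (fun s => ?_) s <;> simp [(Fin.succ_ne_zero _).symm]

/-- The cochain `(a₀, …, aₙ) ↦ f (a₀, …, aₙ₋₁) · aₙ`. -/
def rightTerm {n : ℕ} (R : A →ₗ[k] M →ₗ[k] M) (f : Cochain k A M n) : Cochain k A M (n + 1) where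
  toFun a := R (a (Fin.last n)) (f (Fin.init a))
  map_update_add' {inst} a s x y := by
    obtain rfl : inst = instDecidableEqFin (n + 1) := Subsingleton.elim _ _
    refine Fin.lastCases ?_ (fun s => ?_) s <;> simp [(Fin.castSucc_lt_last _).ne']
  map_update_smul' {inst} a s c x := by
    obtain rfl : inst = instDecidableEqFin (n + 1) := Subsingleton.elim _ _
    refine Fin.lastCases ?_ (fun s => ?_) s <;> simp [(Fin.castSucc_lt_last _).ne']

/-- The Hochschild differential of cochains with coefficients in a bimodule `M`, whose left and
right actions are `a · m = L a m` and `m · a = R a m`: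
`(δ f) (a₀, …, aₙ) = a₀ · f (a₁, …, aₙ) + ∑_{i < n} (-1)^(i + 1) f (…, aᵢ aᵢ₊₁, …)
  + (-1)^(n + 1) f (a₀, …, aₙ₋₁) · aₙ`. -/
def differential (L R : A →ₗ[k] M →ₗ[k] M) (n : ℕ) :
    Cochain k A M n →ₗ[k] Cochain k A M (n + 1) where
  toFun f := leftTerm L f +
    ∑ i : Fin n, (-1 : k) ^ ((i : ℕ) + 1) • partialComp (deg_mul n) i f (mulCochain k A) +
    (-1 : k) ^ (n + 1) • rightTerm R f
  map_add' f g := by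
    ext a
    simp [leftTerm, rightTerm, Finset.sum_add_distrib]
    abel
  map_smul' c f := by
    ext a
    simp [leftTerm, rightTerm, Finset.smul_sum, smul_comm c]

theorem insertArgs_mul {n : ℕ} (i : Fin n) (a : Fin (n + 1) → A) :
    insertArgs (deg_mul n) i (mulCochain k A) a = Fin.contractNth i.castSucc (· * ·) a := by
  funext j
  simp only [insertArgs, Fin.contractNth, mulCochain_apply]
  simp only [Fin.val_castSucc]
  split_ifs with h1 h2 h3 h3 <;> first | rfl | skip
  · subst h2
    rfl
  · exact absurd (congrArg Fin.val h2) h3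
  · exact absurd (Fin.ext h3) h2

theorem differential_apply (L R : A →ₗ[k] M →ₗ[k] M) {n : ℕ} (f : Cochain k A M n)
    (a : Fin (n + 1) → A) : differential L R n f a = L (a 0) (f (Fin.tail a)) +
      ∑ i : Fin n, (-1 : k) ^ ((i : ℕ) + 1) • f (Fin.contractNth i.castSucc (· * ·) a) +
      (-1 : k) ^ (n + 1) • R (a (Fin.last n)) (f (Fin.init a)) := by
  simp [differential, leftTerm, rightTerm, insertArgs_mul]

/-- The `n`-cocycles. -/
def cocycles (L R : A →ₗ[k] M →ₗ[k] M) (n : ℕ) : Submodule k (Cochain k A M n) :=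
  LinearMap.ker (differential L R n)

/-- The `n`-coboundaries. -/
def coboundaries (L R : A →ₗ[k] M →ₗ[k] M) : (n : ℕ) → Submodule k (Cochain k A M n)
  | 0 => ⊥
  | n + 1 => LinearMap.range (differential L R n)

/-- The cohomology in degree `n`, cocycles modulo coboundaries. -/
def Cohomology (L R : A →ₗ[k] M →ₗ[k] M) (n : ℕ) :=
  cocycles L R n ⧸ (coboundaries L R n).submoduleOf (cocycles L R n)

instance (L R : A →ₗ[k] M →ₗ[k] M) (n : ℕ) : AddCommGroup (Cohomology L R n) :=
  inferInstanceAs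
    (AddCommGroup (cocycles L R n ⧸ (coboundaries L R n).submoduleOf (cocycles L R n)))

instance (L R : A →ₗ[k] M →ₗ[k] M) (n : ℕ) : Module k (Cohomology L R n) :=
  inferInstanceAs
    (Module k (cocycles L R n ⧸ (coboundaries L R n).submoduleOf (cocycles L R n)))

/-- The class of a cocycle. -/
def Cohomology.mk (L R : A →ₗ[k] M →ₗ[k] M) (n : ℕ) : cocycles L R n →ₗ[k] Cohomology L R n :=
  ((coboundaries L R n).submoduleOf (cocycles L R n)).mkQ

theorem Cohomology.mk_surjective (L R : A →ₗ[k] M →ₗ[k] M) (n : ℕ) :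
    Function.Surjective (Cohomology.mk L R n) :=
  Submodule.mkQ_surjective _

theorem Cohomology.mk_eq_zero (L R : A →ₗ[k] M →ₗ[k] M) (n : ℕ) (f : cocycles L R n) :
    Cohomology.mk L R n f = 0 ↔ (f : Cochain k A M n) ∈ coboundaries L R n :=
  Submodule.Quotient.mk_eq_zero _

/-- Linear maps out of cohomology. -/
def Cohomology.lift {L R : A →ₗ[k] M →ₗ[k] M} {n : ℕ} {U : Type*} [AddCommGroup U] [Module k U]
    (φ : cocycles L R n →ₗ[k] U) (h : ∀ f : cocycles L R n, (f : Cochain k A M n) ∈ coboundaries L R n → φ f = 0) :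
    Cohomology L R n →ₗ[k] U :=
  Submodule.liftQ _ φ h

theorem Cohomology.lift_mk {L R : A →ₗ[k] M →ₗ[k] M} {n : ℕ} {U : Type*} [AddCommGroup U]
    [Module k U] (φ : cocycles L R n →ₗ[k] U)
    (h : ∀ f : cocycles L R n, (f : Cochain k A M n) ∈ coboundaries L R n → φ f = 0) (f : cocycles L R n) :
    Cohomology.lift φ h (Cohomology.mk L R n f) = φ f := rfl

/-- A chain map induces a map on cohomology. -/
def Cohomology.map {A' M' : Type*} [Ring A'] [Algebra k A'] [AddCommGroup M'] [Module k M']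
    {L R : A →ₗ[k] M →ₗ[k] M} {L' R' : A' →ₗ[k] M' →ₗ[k] M'}
    (φ : (n : ℕ) → Cochain k A M n →ₗ[k] Cochain k A' M' n)
    (hφ : ∀ n f, differential L' R' n (φ n f) = φ (n + 1) (differential L R n f)) (n : ℕ) :
    Cohomology L R n →ₗ[k] Cohomology L' R' n :=
  Cohomology.lift (Cohomology.mk L' R' n ∘ₗ
    LinearMap.restrict (φ n) (p := cocycles L R n) (q := cocycles L' R' n) (fun f hf => by
      rw [cocycles, LinearMap.mem_ker] at hf ⊢
      rw [hφ, hf, map_zero]))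
    (by
      rintro ⟨f, hf⟩ hf'
      rw [LinearMap.comp_apply, Cohomology.mk_eq_zero]
      change f ∈ coboundaries L R n at hf'
      change φ n f ∈ coboundaries L' R' n
      cases n with
      | zero =>
        rw [coboundaries, Submodule.mem_bot] at hf' ⊢
        simpa using congrArg (φ 0) hf'
      | succ n =>
        obtain ⟨h, hh⟩ := hf'
        exact ⟨φ n h, by rw [hφ, hh]⟩)

theorem Cohomology.map_mk {A' M' : Type*} [Ring A'] [Algebra k A'] [AddCommGroup M'] [Module k M']
    {L R : A →ₗ[k] M →ₗ[k] M} {L' R' : A' →ₗ[k] M' →ₗ[k] M'}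
    (φ : (n : ℕ) → Cochain k A M n →ₗ[k] Cochain k A' M' n)
    (hφ : ∀ n f, differential L' R' n (φ n f) = φ (n + 1) (differential L R n f)) (n : ℕ)
    (f : cocycles L R n) (hf : φ n f ∈ cocycles L' R' n) :
    Cohomology.map φ hφ n (Cohomology.mk L R n f) = Cohomology.mk L' R' n ⟨φ n f, hf⟩ := rfl

variable (k A) in
/-- The Hochschild cohomology `HH^n(A) = Ext^n_{A^e}(A, A)`, computed by the Hochschild complex. -/
abbrev HochschildCohomology (n : ℕ) :=
  Cohomology (LinearMap.mul k A) (LinearMap.mul k A).flip n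

/-- The Hochschild differential on cochains with values in `A`. -/
abbrev hochschildDifferential (n : ℕ) : Cochain k A A n →ₗ[k] Cochain k A A (n + 1) :=
  differential (LinearMap.mul k A) (LinearMap.mul k A).flip n

theorem hochschildDifferential_eq {n : ℕ} (f : Cochain k A A n) :
    hochschildDifferential n f = -bracket (deg_mul n) f (mulCochain k A) := by
  ext a
  rw [hochschildDifferential, differential_apply, bracket_apply]
  have e0 : (insertArgs ((add_comm 2 n).trans (deg_mul n)) 0 f a) =
      ![f (Fin.init a), a (Fin.last n)] := by
    funext j
    fin_cases j
    · simp [insertArgs, Fin.init_def]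
      congr 1
      funext l
      congr 1
      ext
      simp
    · simp [insertArgs]
      congr 1
      ext
      simp
  have e1 : (insertArgs ((add_comm 2 n).trans (deg_mul n)) 1 f a) =
      ![a 0, f (Fin.tail a)] := by
    funext j
    fin_cases j
    · simp [insertArgs]
    · simp [insertArgs, Fin.tail_def]
      congr 1
      funext l
      congr 1
      ext
      simp
      omega
  have s1 : (-1 : k) ^ ((n + 1) * (2 + 1)) = (-1 : k) ^ (n + 1) := by
    rw [show (n + 1) * (2 + 1) = 2 * (n + 1) + (n + 1) by ring, pow_add, pow_mul]
    simp
  have s2 : ∀ i : ℕ, (-1 : k) ^ (i * (2 + 1)) = (-1 : k) ^ i := by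
    intro i
    rw [show i * (2 + 1) = 2 * i + i by ring, pow_add, pow_mul]
    simp
  simp only [neg_apply, sub_apply, smul_apply, circ_apply, Fin.sum_univ_two,
    insertArgs_mul, e0, e1, s1, s2]
  simp only [LinearMap.mul_apply', LinearMap.flip_apply, pow_succ]
  simp [pow_succ]
  rw [smul_smul, ← mul_pow]
  simp
  abel

theorem mem_cocycles_iff_bracket {n : ℕ} (f : Cochain k A A n) :
    f ∈ cocycles (LinearMap.mul k A) (LinearMap.mul k A).flip n ↔
      bracket (deg_mul n) f (mulCochain k A) = 0 := by
  rw [cocycles, LinearMap.mem_ker]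
  rw [show differential _ _ n f = _ from hochschildDifferential_eq f, neg_eq_zero]

theorem bracket_mem_cocycles {p q r : ℕ} (h : p + q = r + 1) {f : Cochain k A A p}
    {g : Cochain k A A q} (hf : f ∈ cocycles (LinearMap.mul k A) (LinearMap.mul k A).flip p)
    (hg : g ∈ cocycles (LinearMap.mul k A) (LinearMap.mul k A).flip q) :
    bracket h f g ∈ cocycles (LinearMap.mul k A) (LinearMap.mul k A).flip r := by
  rw [mem_cocycles_iff_bracket] at hf hg ⊢
  rw [jacobi h (deg_mul r) (deg_mul q) (show p + (q + 1) = r + 1 + 1 by omega) (deg_mul p)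
    (show p + 1 + q = r + 1 + 1 by omega), hf, hg]
  simp

theorem bracket_differential_left {p q r : ℕ} (h : p + q = r + 1) (f : Cochain k A A p)
    {g : Cochain k A A q} (hg : g ∈ cocycles (LinearMap.mul k A) (LinearMap.mul k A).flip q) :
    bracket (show p + 1 + q = r + 1 + 1 by omega) (hochschildDifferential p f) g =
      (-1 : k) ^ (q + 1) • hochschildDifferential r (bracket h f g) := by
  rw [mem_cocycles_iff_bracket] at hg
  rw [hochschildDifferential_eq, hochschildDifferential_eq,
    jacobi h (deg_mul r) (deg_mul q) (show p + (q + 1) = r + 1 + 1 by omega) (deg_mul p)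
    (show p + 1 + q = r + 1 + 1 by omega), hg]
  have s1 : (-1 : k) ^ ((q + 1) * (2 + 1)) = (-1 : k) ^ (q + 1) := by
    rw [show (q + 1) * (2 + 1) = 2 * (q + 1) + (q + 1) by ring, pow_add, pow_mul]
    simp
  simp [s1, smul_smul, ← mul_pow]

theorem bracket_antisymm {p q r : ℕ} (h : p + q = r + 1) (f : Cochain k A A p)
    (g : Cochain k A A q) : bracket h f g =
      -((-1 : k) ^ ((p + 1) * (q + 1)) • bracket ((add_comm q p).trans h) g f) := by
  rw [bracket_apply, bracket_apply, mul_comm (q + 1)]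
  rcases neg_one_pow_eq_or k ((p + 1) * (q + 1)) with c | c <;> rw [c] <;> module

theorem bracket_mem_coboundaries_left {p q r : ℕ} (hp : 0 < p) (hq : 0 < q) (h : p + q = r + 1)
    {f : Cochain k A A p} {g : Cochain k A A q}
    (hf : f ∈ coboundaries (LinearMap.mul k A) (LinearMap.mul k A).flip p)
    (hg : g ∈ cocycles (LinearMap.mul k A) (LinearMap.mul k A).flip q) :
    bracket h f g ∈ coboundaries (LinearMap.mul k A) (LinearMap.mul k A).flip r := by
  obtain ⟨p, rfl⟩ := Nat.exists_eq_succ_of_ne_zero hp.ne'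
  obtain ⟨r, rfl⟩ := Nat.exists_eq_succ_of_ne_zero (show r ≠ 0 by omega)
  obtain ⟨f, rfl⟩ := hf
  have := bracket_differential_left (show p + q = r + 1 by omega) f hg
  exact ⟨(-1 : k) ^ (q + 1) • bracket (by omega) f g, by rw [map_smul]; exact this.symm⟩

theorem bracket_mem_coboundaries_right {p q r : ℕ} (hp : 0 < p) (hq : 0 < q) (h : p + q = r + 1)
    {f : Cochain k A A p} {g : Cochain k A A q}
    (hf : f ∈ cocycles (LinearMap.mul k A) (LinearMap.mul k A).flip p)
    (hg : g ∈ coboundaries (LinearMap.mul k A) (LinearMap.mul k A).flip q) :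
    bracket h f g ∈ coboundaries (LinearMap.mul k A) (LinearMap.mul k A).flip r := by
  rw [bracket_antisymm]
  exact Submodule.neg_mem _ (Submodule.smul_mem _ _ (bracket_mem_coboundaries_left hq hp _ hg hf))

/-- The bracket of two Hochschild cocycles, as a cocycle. -/
def cocycleBracket {p q r : ℕ} (h : p + q = r + 1) :
    cocycles (LinearMap.mul k A) (LinearMap.mul k A).flip p →ₗ[k]
      cocycles (LinearMap.mul k A) (LinearMap.mul k A).flip q →ₗ[k]
        cocycles (LinearMap.mul k A) (LinearMap.mul k A).flip r :=
  LinearMap.mk₂ k (fun f g => ⟨bracket h f.1 g.1, bracket_mem_cocycles h f.2 g.2⟩)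
    (fun f f' g => by ext1; simp)
    (fun c f g => by ext1; simp)
    (fun f g g' => by ext1; simp)
    (fun c f g => by ext1; simp)

theorem cocycleBracket_coe {p q r : ℕ} (h : p + q = r + 1)
    (f : cocycles (LinearMap.mul k A) (LinearMap.mul k A).flip p)
    (g : cocycles (LinearMap.mul k A) (LinearMap.mul k A).flip q) :
    (cocycleBracket h f g : Cochain k A A r) = bracket h f.1 g.1 := rfl

/-- The Gerstenhaber bracket `HH^p(A) × HH^q(A) → HH^{p + q - 1}(A)` in positive degrees,
induced by the bracket of cochains. -/
def gerstenhaberBracket {p q r : ℕ} (hp : 0 < p) (hq : 0 < q) (h : p + q = r + 1) :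
    HochschildCohomology k A p →ₗ[k] HochschildCohomology k A q →ₗ[k]
      HochschildCohomology k A r :=
  Cohomology.lift
    (LinearMap.flip (Cohomology.lift
      ((cocycleBracket h).compr₂ (Cohomology.mk _ _ r)).flip
      (fun g hg => by
        ext1 f
        exact (Cohomology.mk_eq_zero _ _ _ _).2
          (bracket_mem_coboundaries_right hp hq h f.2 hg))))
    (fun f hf => by
      ext1 g
      obtain ⟨g, rfl⟩ := Cohomology.mk_surjective _ _ _ g
      exact (Cohomology.mk_eq_zero _ _ _ _).2
        (bracket_mem_coboundaries_left hp hq h hf g.2))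

theorem gerstenhaberBracket_mk {p q r : ℕ} (hp : 0 < p) (hq : 0 < q) (h : p + q = r + 1)
    (f : cocycles (LinearMap.mul k A) (LinearMap.mul k A).flip p)
    (g : cocycles (LinearMap.mul k A) (LinearMap.mul k A).flip q) :
    gerstenhaberBracket hp hq h (Cohomology.mk _ _ p f) (Cohomology.mk _ _ q g) =
      Cohomology.mk _ _ r ⟨bracket h f.1 g.1, bracket_mem_cocycles h f.2 g.2⟩ := rfl

end Cohomology

/-! ### The embedding of Hopf algebra cohomology into Hochschild cohomology -/

section Embedding

variable {k : Type*} [Field k] {A : Type*} [Ring A]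

/-- Naturality of the Hochschild differential in the algebra. -/
theorem differential_compLinearMap {B M : Type*} [Ring B] [Algebra k A] [Algebra k B]
    [AddCommGroup M] [Module k M] (φ : A →ₐ[k] B) (L R : B →ₗ[k] M →ₗ[k] M) {n : ℕ}
    (f : Cochain k B M n) :
    differential (L ∘ₗ φ.toLinearMap) (R ∘ₗ φ.toLinearMap) n
      (f.compLinearMap fun _ => φ.toLinearMap) =
        (differential L R n f).compLinearMap fun _ => φ.toLinearMap := by
  ext a
  simp only [differential_apply, MultilinearMap.compLinearMap_apply, LinearMap.comp_apply,
    AlgHom.toLinearMap_apply]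
  congr 3
  funext i
  congr 2
  funext j
  simp only [Fin.contractNth]
  split_ifs <;> simp

section Ext

variable [Algebra k A]

theorem ext_tmul {M : Type*} [AddCommGroup M] [Module k M] {n : ℕ}
    {f g : Cochain k (A ⊗[k] A) M n}
    (h : ∀ b c : Fin n → A, f (fun i => b i ⊗ₜ c i) = g (fun i => b i ⊗ₜ c i)) : f = g := by
  let e := Module.Basis.ofVectorSpace k A
  refine Module.Basis.ext_multilinear (fun _ => e.tensorProduct e) fun v => ?_
  simpa [Module.Basis.tensorProduct_apply'] using h (fun i => e (v i).1) (fun i => e (v i).2)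

/-- For `f : A^{⊗ n} → k`, the cochain
`(b₁ ⊗ c₁, …, bₙ ⊗ cₙ) ↦ f (b₁, …, bₙ) c₁ ⋯ cₙ` on `A ⊗ A`. -/
def twist : (n : ℕ) → Cochain k A k n →ₗ[k] Cochain k (A ⊗[k] A) A n
  | 0 =>
    { toFun f := MultilinearMap.constOfIsEmpty k _ (algebraMap k A (f Fin.elim0))
      map_add' f g := by ext; simp
      map_smul' c f := by ext; simp [Algebra.smul_def] }
  | n + 1 =>
    { toFun f := LinearMap.uncurryLeft (TensorProduct.lift
        ((LinearMap.mk₂ k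
          (fun (φ : Cochain k (A ⊗[k] A) A n) (c : A) =>
            (LinearMap.mulLeft k c).compMultilinearMap φ)
          (fun φ φ' c => by ext; simp)
          (fun x φ c => by ext; simp)
          (fun φ c c' => by ext; simp [add_mul])
          (fun x φ c => by ext; simp)) ∘ₗ twist n ∘ₗ f.curryLeft))
      map_add' f g := by
        refine ext_tmul fun b c => ?_
        have : (f + g).curryLeft = f.curryLeft + g.curryLeft := by ext; rfl
        simp [this]
      map_smul' x f := by
        refine ext_tmul fun b c => ?_
        have : (x • f).curryLeft = x • f.curryLeft := by ext; rfl
        simp [this] }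

theorem twist_tmul : ∀ {n : ℕ} (f : Cochain k A k n) (b c : Fin n → A),
    twist n f (fun i => b i ⊗ₜ c i) = f b • (List.ofFn c).prod
  | 0, f, b, c => by
    rw [Subsingleton.elim b Fin.elim0]
    simp [twist, Algebra.algebraMap_eq_smul_one]
  | n + 1, f, b, c => by
    have ih := twist_tmul (f.curryLeft (b 0)) (Fin.tail b) (Fin.tail c)
    have e : (Fin.tail fun i => b i ⊗ₜ[k] c i) = fun i => Fin.tail b i ⊗ₜ[k] Fin.tail c i := rfl
    simp only [twist, LinearMap.coe_mk, AddHom.coe_mk, LinearMap.uncurryLeft_apply,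
      TensorProduct.lift.tmul, LinearMap.comp_apply, LinearMap.mk₂_apply,
      LinearMap.compMultilinearMap_apply, LinearMap.mulLeft_apply, e, ih]
    rw [MultilinearMap.curryLeft_apply, Fin.cons_self_tail, List.ofFn_succ, List.prod_cons,
      mul_smul_comm]
    rfl

theorem prod_contractNth {n : ℕ} (i : Fin n) (c : Fin (n + 1) → A) :
    (List.ofFn (Fin.contractNth i.castSucc (· * ·) c)).prod = (List.ofFn c).prod := by
  have key : ∀ {m : ℕ} (c : Fin m → A), (List.ofFn c).prod = Fin.partialProd c (Fin.last m) := by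
    intro m c
    rw [Fin.partialProd, Fin.val_last, List.take_of_length_le (by simp)]
  rw [key, key, Fin.partialProd_contractNth, Function.comp_apply,
    Fin.succAbove_of_le_castSucc _ _ (by simp [Fin.le_def]), Fin.succ_last]

end Ext

variable [HopfAlgebra k A]

variable (k A) in
/-- The action of `A` on the trivial module `k` through the counit. -/
def trivialAction : A →ₗ[k] k →ₗ[k] k := LinearMap.lsmul k k ∘ₗ Coalgebra.counit

variable (k A) in
/-- The Hopf algebra cohomology `H^n(A, k) = Ext^n_A(k, k)`, computed by the bar resolution of the
trivial module `k`: the cochains are `Hom_k(A^{⊗ n}, k)`, with differential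
`(d f) (a₀, …, aₙ) = ε(a₀) f (a₁, …, aₙ) + ∑_{i < n} (-1)^(i + 1) f (…, aᵢ aᵢ₊₁, …)
  + (-1)^(n + 1) f (a₀, …, aₙ₋₁) ε(aₙ)`. -/
abbrev HopfCohomology (n : ℕ) := Cohomology (trivialAction k A) (trivialAction k A) n

/-- The cochain map underlying the embedding of Hopf algebra cohomology into Hochschild cohomology,
`f ↦ ((a₁, …, aₙ) ↦ ∑ f (a₁', …, aₙ') a₁'' ⋯ aₙ'')` with `Δ a = ∑ a' ⊗ a''`. -/
def embedCochain (n : ℕ) : Cochain k A k n →ₗ[k] Cochain k A A n where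
  toFun f := (twist n f).compLinearMap fun _ => Coalgebra.comul
  map_add' f g := by ext; simp
  map_smul' c f := by ext; simp

theorem embedCochain_differential (n : ℕ) (f : Cochain k A k n) :
    hochschildDifferential n (embedCochain n f) =
      embedCochain (n + 1) (differential (trivialAction k A) (trivialAction k A) n f) := by
  let E : A ⊗[k] A →ₗ[k] A :=
    (TensorProduct.lid k A).toLinearMap ∘ₗ LinearMap.rTensor A Coalgebra.counit
  have hE : ∀ b c : A, E (b ⊗ₜ c) = (Coalgebra.counit b : k) • c := fun b c => by simp [E]
  have hΔ : ∀ a : A, E (Bialgebra.comulAlgHom k A a) = a := fun a => by simp [E]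
  have h1 : (LinearMap.mul k A ∘ₗ E) ∘ₗ (Bialgebra.comulAlgHom k A).toLinearMap =
      LinearMap.mul k A := by
    ext a b
    simp only [LinearMap.comp_apply, AlgHom.toLinearMap_apply, hΔ]
  have h2 : ((LinearMap.mul k A).flip ∘ₗ E) ∘ₗ (Bialgebra.comulAlgHom k A).toLinearMap =
      (LinearMap.mul k A).flip := by
    ext a b
    simp only [LinearMap.comp_apply, AlgHom.toLinearMap_apply, hΔ]
  have key : differential (LinearMap.mul k A ∘ₗ E) ((LinearMap.mul k A).flip ∘ₗ E) n
      (twist n f) = twist (n + 1) (differential (trivialAction k A) (trivialAction k A) n f) := by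
    refine ext_tmul fun b c => ?_
    have e1 : (Fin.tail fun i => b i ⊗ₜ[k] c i) = fun i => Fin.tail b i ⊗ₜ[k] Fin.tail c i := rfl
    have e2 : (Fin.init fun i => b i ⊗ₜ[k] c i) = fun i => Fin.init b i ⊗ₜ[k] Fin.init c i := rfl
    have e3 : ∀ i : Fin n, (Fin.contractNth i.castSucc (· * ·) fun i => b i ⊗ₜ[k] c i) =
        fun j => Fin.contractNth i.castSucc (· * ·) b j ⊗ₜ[k]
          Fin.contractNth i.castSucc (· * ·) c j := by
      intro i
      funext j
      simp only [Fin.contractNth]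
      split_ifs <;> simp
    have e4 : (List.ofFn c).prod = c 0 * (List.ofFn (Fin.tail c)).prod := by
      rw [List.ofFn_succ, List.prod_cons]
      rfl
    have e5 : (List.ofFn c).prod = (List.ofFn (Fin.init c)).prod * c (Fin.last n) := by
      rw [List.ofFn_succ', List.concat_eq_append, List.prod_append, List.prod_singleton]
      rfl
    rw [twist_tmul, differential_apply, differential_apply, e1, e2]
    simp only [e3, twist_tmul, prod_contractNth, LinearMap.comp_apply, hE, LinearMap.mul_apply',
      LinearMap.flip_apply, trivialAction, LinearMap.lsmul_apply, add_smul, Finset.sum_smul,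
      smul_eq_mul]
    congr 1
    · congr 1
      · rw [e4, smul_mul_assoc, mul_smul_comm, smul_smul]
      · simp only [smul_smul]
    · rw [e5, smul_mul_assoc, mul_smul_comm, smul_smul, smul_smul, mul_assoc,
        mul_comm (f _)]
  have h3 := differential_compLinearMap (Bialgebra.comulAlgHom k A) (LinearMap.mul k A ∘ₗ E)
    ((LinearMap.mul k A).flip ∘ₗ E) (twist n f)
  rw [h1, h2, key] at h3
  exact h3

/-- The embedding `H^n(A, k) → HH^n(A)`: on cochains, the map induced by the unit `k → A`, from
`Hom_k(A^{⊗ n}, k)` to the bar cochains `Hom_k(A^{⊗ n}, A^{ad})` with values in the left adjoint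
module, followed by the isomorphism of the latter complex with the Hochschild complex that sends
`f` to `(a₁, …, aₙ) ↦ ∑ f (a₁', …, aₙ') a₁'' ⋯ aₙ''`. -/
def embedding (n : ℕ) : HopfCohomology k A n →ₗ[k] HochschildCohomology k A n :=
  Cohomology.map embedCochain embedCochain_differential n

/-- The map of Hochschild cochains `f ↦ ε ∘ f`, a retraction of `embedCochain`. -/
def counitCochain (n : ℕ) : Cochain k A A n →ₗ[k] Cochain k A k n where
  toFun f := (Coalgebra.counit : A →ₗ[k] k).compMultilinearMap f
  map_add' f g := by ext; simp
  map_smul' c f := by ext; simp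

theorem counitCochain_differential (n : ℕ) (f : Cochain k A A n) :
    differential (trivialAction k A) (trivialAction k A) n (counitCochain n f) =
      counitCochain (n + 1) (hochschildDifferential n f) := by
  ext a
  simp [differential_apply, counitCochain, trivialAction, mul_comm]

theorem counitCochain_embedCochain (n : ℕ) (f : Cochain k A k n) :
    counitCochain n (embedCochain n f) = f := by
  let E : A ⊗[k] A →ₗ[k] A :=
    (TensorProduct.rid k A).toLinearMap ∘ₗ LinearMap.lTensor A Coalgebra.counit
  have hE : ∀ b c : A, E (b ⊗ₜ c) = (Coalgebra.counit c : k) • b := fun b c => by simp [E]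
  have hΔ : ∀ a : A, E (Coalgebra.comul a) = a := fun a => by simp [E]
  have key : (Coalgebra.counit : A →ₗ[k] k).compMultilinearMap (twist n f) =
      f.compLinearMap fun _ => E := by
    refine ext_tmul fun b c => ?_
    have h1 : Coalgebra.counit (R := k) (List.ofFn c).prod =
        ∏ i, (Coalgebra.counit (c i) : k) := by
      rw [← Bialgebra.counitAlgHom_apply, map_list_prod, List.map_ofFn, List.prod_ofFn]
      rfl
    simp only [LinearMap.compMultilinearMap_apply, twist_tmul, map_smul, h1,
      MultilinearMap.compLinearMap_apply, hE, MultilinearMap.map_smul_univ, smul_eq_mul]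
    rw [mul_comm]
  ext a
  have := MultilinearMap.congr_fun key (fun i => Coalgebra.comul (a i))
  simp only [MultilinearMap.compLinearMap_apply, hΔ] at this
  exact this

theorem embedding_injective (n : ℕ) : Function.Injective (embedding (k := k) (A := A) n) := by
  refine Function.LeftInverse.injective
    (g := Cohomology.map counitCochain counitCochain_differential n) fun α => ?_
  obtain ⟨f, rfl⟩ := Cohomology.mk_surjective _ _ _ α
  have h1 : counitCochain n (embedCochain n f.1) ∈
      cocycles (trivialAction k A) (trivialAction k A) n := by
    rw [counitCochain_embedCochain]
    exact f.2
  change Cohomology.mk _ _ n ⟨counitCochain n (embedCochain n f.1), h1⟩ = _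
  congr 1
  ext1
  exact counitCochain_embedCochain n f.1

end Embedding

end QuantumElementaryAbelian

/-! The theorem follows from a parity argument resting on two facts.

The first holds for every Hopf algebra: the image of `embedding` is closed under the bracket in
positive degrees. For $F = \iota(f)$, multiplicativity and coassociativity of $\Delta$ give $\Delta
F(a_1,\dots,a_n) = \sum F(a_1',\dots,a_n') \otimes a_1''\cdots a_n''$, so $F$ is right colinear
(`comul_embedCochain`). Hence $\iota(f)\circ_i\iota(g) = \iota(f\circ_i\iota(g))$ already on
cochains (`partialComp_embedCochain`), and the bracket of two embedded classes comes from a class in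
$\mathrm H^{p+q-1}(A,k)$.

The second is that $\mathrm H^{odd}(A,k)=0$ for a quantum elementary abelian group. So if $p$ or $q$
is odd, one argument of the bracket is zero; if both are even, $p+q-1$ is odd and the bracket is the
image of zero.

The odd vanishing is proved by adjoining one Taft factor $T$ to an augmented algebra $B$
(`taft_tensor_vanishes`). For a $B$-module $N$ let $M_m(\chi)$ be the $T\otimes B$-module `taftRep`
of $m$-tuples. Since the group algebra of $\langle g\rangle$ is semisimple, $M_n(\chi)$ has no
cohomology for $\chi\ne1$ (`taftRep_vanishes_of_ne_one`), while the cohomology of $M_n(1)$ is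
controlled by that of $N$ over $B$ (`taftRep_vanishes`). The exact sequences $0\to M_1(1)\to
M_n(1)\to M_{n-1}(\omega^{-1})\to0$ and $0\to M_{n-1}(\omega^{-1})\to M_n(\omega^{-1})\to
M_1(1)\to0$ then carry vanishing from degree $2i-1$ to degree $2i+1$ for $M_1(1)$
(`taftRep_one_vanishes`), which is the trivial module when $N=k$. Everything is done with bar
cochains, long exact sequences and dimension shifting along coinduced modules. -/

namespace QuantumElementaryAbelian

/-! ### Colinear cochains and closure under the bracket. -/

section Colinear

variable {k : Type*} [Field k] {A : Type*} [Ring A]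

theorem ext_tmul_right [Algebra k A] {R M : Type*} [Ring R] [Algebra k R] [AddCommGroup M]
    [Module k M] {n : ℕ} {f g : Cochain k (A ⊗[k] R) M n}
    (h : ∀ (b : Fin n → A) (c : Fin n → R), f (fun i => b i ⊗ₜ c i) = g (fun i => b i ⊗ₜ c i)) :
    f = g := by
  let e := Module.Basis.ofVectorSpace k A
  let e' := Module.Basis.ofVectorSpace k R
  refine Module.Basis.ext_multilinear (fun _ => e.tensorProduct e') fun v => ?_
  simpa [Module.Basis.tensorProduct_apply'] using h (fun i => e (v i).1) (fun i => e' (v i).2)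

/-- For a cochain `f` on `A` and an algebra `R`, the cochain
`(b₁ ⊗ c₁, …, bₙ ⊗ cₙ) ↦ f (b₁, …, bₙ) ⊗ c₁ ⋯ cₙ` on `A ⊗ R`. -/
noncomputable def tensorCochain [Algebra k A] (R : Type*) [Ring R] [Algebra k R] {M : Type*}
    [AddCommGroup M] [Module k M] : (n : ℕ) → Cochain k A M n →ₗ[k] Cochain k (A ⊗[k] R) (M ⊗[k] R) n
  | 0 =>
    { toFun f := MultilinearMap.constOfIsEmpty k _ (f Fin.elim0 ⊗ₜ 1)
      map_add' f g := by ext; simp [TensorProduct.add_tmul]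
      map_smul' c f := by ext; simp [TensorProduct.smul_tmul'] }
  | n + 1 =>
    { toFun f := LinearMap.uncurryLeft (TensorProduct.lift
        ((LinearMap.mk₂ k
          (fun (φ : Cochain k (A ⊗[k] R) (M ⊗[k] R) n) (c : R) =>
            ((LinearMap.mulLeft k c).lTensor M).compMultilinearMap φ)
          (fun φ φ' c => by ext; simp)
          (fun x φ c => by ext; simp)
          (fun φ c c' => by
            ext
            have : LinearMap.mulLeft k (c + c') = LinearMap.mulLeft k c + LinearMap.mulLeft k c' := by
              ext; simp [add_mul]
            simp [this, LinearMap.lTensor_add])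
          (fun x φ c => by
            ext
            have : LinearMap.mulLeft k (x • c) = x • LinearMap.mulLeft k c := by
              ext; simp
            simp [this, LinearMap.lTensor_smul])) ∘ₗ tensorCochain R n ∘ₗ f.curryLeft))
      map_add' f g := by
        refine ext_tmul_right fun b c => ?_
        have : (f + g).curryLeft = f.curryLeft + g.curryLeft := by ext; rfl
        simp [this]
      map_smul' x f := by
        refine ext_tmul_right fun b c => ?_
        have : (x • f).curryLeft = x • f.curryLeft := by ext; rfl
        simp [this] }

theorem tensorCochain_tmul [Algebra k A] {R : Type*} [Ring R] [Algebra k R] {M : Type*}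
    [AddCommGroup M] [Module k M] : ∀ {n : ℕ} (f : Cochain k A M n) (b : Fin n → A) (c : Fin n → R),
    tensorCochain R n f (fun i => b i ⊗ₜ c i) = f b ⊗ₜ (List.ofFn c).prod
  | 0, f, b, c => by
    rw [Subsingleton.elim b Fin.elim0]
    simp [tensorCochain]
  | n + 1, f, b, c => by
    have ih := tensorCochain_tmul (f.curryLeft (b 0)) (Fin.tail b) (Fin.tail c)
    have e : (Fin.tail fun i => b i ⊗ₜ[k] c i) = fun i => Fin.tail b i ⊗ₜ[k] Fin.tail c i := rfl
    simp only [tensorCochain, LinearMap.coe_mk, AddHom.coe_mk, LinearMap.uncurryLeft_apply,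
      TensorProduct.lift.tmul, LinearMap.comp_apply, LinearMap.mk₂_apply,
      LinearMap.compMultilinearMap_apply, e, ih, LinearMap.lTensor_tmul, LinearMap.mulLeft_apply]
    rw [MultilinearMap.curryLeft_apply, Fin.cons_self_tail, List.ofFn_succ, List.prod_cons]
    rfl

theorem prod_ofFn_tmul [Algebra k A] {R : Type*} [Ring R] [Algebra k R] :
    ∀ {n : ℕ} (b : Fin n → A) (c : Fin n → R),
      (List.ofFn fun i => b i ⊗ₜ[k] c i).prod = (List.ofFn b).prod ⊗ₜ (List.ofFn c).prod
  | 0, b, c => by simp [Algebra.TensorProduct.one_def]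
  | n + 1, b, c => by
    simp only [List.ofFn_succ, List.prod_cons, prod_ofFn_tmul (fun i : Fin n => b i.succ),
      Algebra.TensorProduct.tmul_mul_tmul]

/-- Multiplying out a block of consecutive factors beforehand does not change the product. This
handles the second tensor factors when colinear cochains are composed. -/
theorem prod_insertArgs {p q r : ℕ} (h : p + q = r + 1) (i : Fin p) (c : Fin r → A) :
    (List.ofFn (insertArgs h i (fun c => (List.ofFn c).prod) c)).prod = (List.ofFn c).prod := by
  have key : ∀ (n : ℕ) (a : ℕ → A), List.ofFn (fun j : Fin n => a j) = (List.range n).map a := by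
    intro n a
    refine List.ext_getElem (by simp) fun j h1 h2 => by simp
  -- Extension to a sequence, so that lists can be split by `List.range_add`; the value `0` is never
  -- read.
  let a : ℕ → A := fun j => if hj : j < r then c ⟨j, hj⟩ else 0
  have hc : c = fun j : Fin r => a j := by
    funext j
    simp [a]
  have h1 : insertArgs h i (fun c => (List.ofFn c).prod) c =
      fun j : Fin p => insN i q (fun b => ((List.range q).map b).prod) a j := by
    funext j
    simp only [hc, insertArgs, insN, key q (fun l => a (i + l)), Fin.ext_iff]
    split_ifs <;> rfl
  rw [h1, key]
  conv_rhs => rw [hc, key]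
  obtain ⟨i, hi⟩ := i
  obtain ⟨e, rfl⟩ : ∃ e, p = i + 1 + e := ⟨p - (i + 1), by omega⟩
  obtain rfl : r = i + q + e := by omega
  simp only [List.range_add, List.map_append, List.prod_append, List.map_map]
  congr 1
  · congr 1
    · congr 1
      refine List.map_congr_left fun j hj => ?_
      simp [insN, List.mem_range.1 hj]
    · simp [insN, Function.comp_def]
  · congr 1
    refine List.map_congr_left fun j hj => ?_
    simp only [Function.comp_apply, insN]
    rw [if_neg (by omega), if_neg (by omega)]
    congr 1
    omega

variable [HopfAlgebra k A]

/-- Both sides equal $\sum f(a_1',\dots,a_n')\, a_1''\cdots a_n''\otimes a_1'''\cdots a_n'''$: the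
left by multiplicativity of $\Delta$, the right by definition of the embedding, and coassociativity
identifies the two readings of the threefold coproduct. -/
theorem comul_embedCochain {n : ℕ} (f : Cochain k A k n) (a : Fin n → A) :
    Coalgebra.comul (R := k) (embedCochain n f a) =
      tensorCochain A n (embedCochain n f) (fun i => Coalgebra.comul (a i)) := by
  -- The common form of both sides, before the threefold coproducts are substituted.
  let T : Cochain k (A ⊗[k] (A ⊗[k] A)) (A ⊗[k] A) n :=
    (TensorProduct.lid k (A ⊗[k] A)).toLinearMap.compMultilinearMap (tensorCochain (A ⊗[k] A) n f)
  have hT : ∀ (b : Fin n → A) (c : Fin n → A ⊗[k] A),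
      T (fun i => b i ⊗ₜ c i) = f b • (List.ofFn c).prod := fun b c => by
    simp [T, tensorCochain_tmul]
  have h1 : (Coalgebra.comul (R := k) (A := A)).compMultilinearMap (twist n f) =
      T.compLinearMap fun _ => (Coalgebra.comul (R := k) (A := A)).lTensor A := by
    refine ext_tmul fun b c => ?_
    simp only [LinearMap.compMultilinearMap_apply, twist_tmul, map_smul,
      MultilinearMap.compLinearMap_apply, LinearMap.lTensor_tmul, hT]
    rw [← Bialgebra.comulAlgHom_apply, map_list_prod, List.map_ofFn]
    rfl
  -- With the third factors frozen at `c`, this is an identity of cochains on `A ⊗ A`, into which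
  -- coproducts that are not pure tensors may be substituted.
  have h2 : ∀ c : Fin n → A, T.compLinearMap
      (fun i => (TensorProduct.assoc k A A A).toLinearMap ∘ₗ (TensorProduct.mk k _ A).flip (c i)) =
      ((TensorProduct.mk k A A).flip (List.ofFn c).prod).compMultilinearMap (twist n f) := by
    intro c
    refine ext_tmul fun b d => ?_
    simp [hT, twist_tmul, prod_ofFn_tmul, TensorProduct.smul_tmul']
  have h3 : T.compLinearMap (fun _ => (TensorProduct.assoc k A A A).toLinearMap ∘ₗ
      (Coalgebra.comul (R := k) (A := A)).rTensor A) = tensorCochain A n (embedCochain n f) := by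
    refine ext_tmul fun b c => ?_
    have := MultilinearMap.congr_fun (h2 c) (fun i => Coalgebra.comul (b i))
    simp only [MultilinearMap.compLinearMap_apply, LinearMap.comp_apply, LinearMap.flip_apply,
      TensorProduct.mk_apply, LinearMap.compMultilinearMap_apply] at this
    simp only [MultilinearMap.compLinearMap_apply, LinearMap.comp_apply, LinearMap.rTensor_tmul,
      tensorCochain_tmul, this]
    rfl
  rw [← h3]
  refine (MultilinearMap.congr_fun h1 (fun i => Coalgebra.comul (a i))).trans ?_
  simp only [MultilinearMap.compLinearMap_apply, LinearMap.comp_apply, LinearEquiv.coe_coe,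
    Coalgebra.coassoc_apply]

/-- The image of `embedCochain` is closed under partial composition. -/
theorem partialComp_embedCochain {p q r : ℕ} (h : p + q = r + 1) (i : Fin p)
    (f : Cochain k A k p) (g : Cochain k A k q) :
    partialComp h i (embedCochain p f) (embedCochain q g) =
      embedCochain r (partialComp h i f (embedCochain q g)) := by
  -- The identity on `A ⊗ A`, where it can be tested on pure tensors; the theorem is its restriction
  -- along $\Delta$.
  have key : partialComp h i (twist p f) (tensorCochain A q (embedCochain q g)) =
      twist r (partialComp h i f (embedCochain q g)) := by
    refine ext_tmul fun b c => ?_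
    have e : insertArgs h i (tensorCochain A q (embedCochain q g)) (fun j => b j ⊗ₜ[k] c j) =
        fun j => insertArgs h i (embedCochain q g) b j ⊗ₜ[k]
          insertArgs h i (fun c => (List.ofFn c).prod) c j := by
      funext j
      simp only [insertArgs]
      split_ifs
      · rfl
      · exact tensorCochain_tmul _ _ _
      · rfl
    rw [partialComp_apply, e, twist_tmul, twist_tmul, prod_insertArgs, partialComp_apply]
  ext a
  change twist p f (fun j => Coalgebra.comul (insertArgs h i (embedCochain q g) a j)) =
    twist r (partialComp h i f (embedCochain q g)) (fun j => Coalgebra.comul (a j))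
  -- The arguments are compared slot by slot; only slot `i` has content, and there the claim is
  -- colinearity of `embedCochain q g`.
  rw [← key, partialComp_apply]
  congr 1
  funext j
  simp only [insertArgs]
  split_ifs
  · rfl
  · exact comul_embedCochain _ _
  · rfl

theorem circ_embedCochain_mem_range {p q r : ℕ} (h : p + q = r + 1)
    (f : Cochain k A k p) (g : Cochain k A k q) :
    circ h (embedCochain p f) (embedCochain q g) ∈
      LinearMap.range (embedCochain (k := k) (A := A) r) := by
  change ∑ i : Fin p, (-1 : k) ^ ((i : ℕ) * (q + 1)) •
    partialComp h i (embedCochain p f) (embedCochain q g) ∈ _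
  refine Submodule.sum_mem _ fun i _ => Submodule.smul_mem _ _ ?_
  exact ⟨_, (partialComp_embedCochain h i f g).symm⟩

/-- The image of `embedCochain` is closed under the Gerstenhaber bracket. -/
theorem bracket_embedCochain_mem_range {p q r : ℕ} (h : p + q = r + 1)
    (f : Cochain k A k p) (g : Cochain k A k q) :
    bracket h (embedCochain p f) (embedCochain q g) ∈
      LinearMap.range (embedCochain (k := k) (A := A) r) := by
  rw [bracket_apply]
  exact Submodule.sub_mem _ (circ_embedCochain_mem_range _ _ _)
    (Submodule.smul_mem _ _ (circ_embedCochain_mem_range _ _ _))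

end Colinear

/-! ### Bar cochains with coefficients, long exact sequences, coinduced modules. -/

section Vanishing

variable {k : Type*} [Field k] {A : Type u} [Ring A] [Algebra k A]
  {M M' M'' : Type u} [AddCommGroup M] [Module k M] [AddCommGroup M'] [Module k M']
  [AddCommGroup M''] [Module k M'']

theorem differential_compMultilinearMap {L R : A →ₗ[k] M →ₗ[k] M} {L' R' : A →ₗ[k] M' →ₗ[k] M'}
    (φ : M →ₗ[k] M') (hL : ∀ a m, φ (L a m) = L' a (φ m)) (hR : ∀ a m, φ (R a m) = R' a (φ m))
    {n : ℕ} (f : Cochain k A M n) :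
    differential L' R' n (φ.compMultilinearMap f) = φ.compMultilinearMap (differential L R n f) := by
  ext a
  simp [differential_apply, hL, hR]

/-- The right action of an augmented algebra through its augmentation. -/
noncomputable def augAction (ε : A →ₐ[k] k) (M : Type*) [AddCommGroup M] [Module k M] :
    A →ₗ[k] M →ₗ[k] M :=
  LinearMap.lsmul k M ∘ₗ ε.toLinearMap

@[simp]
theorem augAction_apply (ε : A →ₐ[k] k) (a : A) (m : M) : augAction ε M a m = ε a • m := rfl

/-- The differential of the bar cochains of an augmented algebra with values in a left module. -/
noncomputable abbrev barDifferential (ε : A →ₐ[k] k) (ρ : A →ₐ[k] Module.End k M) (n : ℕ) :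
    Cochain k A M n →ₗ[k] Cochain k A M (n + 1) :=
  differential ρ.toLinearMap (augAction ε M) n

/-- The vanishing of the cohomology in degree `n` of an augmented algebra with values in a
left module. -/
def CohomologyVanishes (ε : A →ₐ[k] k) (ρ : A →ₐ[k] Module.End k M) (n : ℕ) : Prop :=
  cocycles ρ.toLinearMap (augAction ε M) n ≤ coboundaries ρ.toLinearMap (augAction ε M) n

variable {ε : A →ₐ[k] k} {ρ : A →ₐ[k] Module.End k M} {ρ' : A →ₐ[k] Module.End k M'}
  {ρ'' : A →ₐ[k] Module.End k M''}

theorem mem_cocycles_bar {n : ℕ} {f : Cochain k A M n} :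
    f ∈ cocycles ρ.toLinearMap (augAction ε M) n ↔ barDifferential ε ρ n f = 0 := Iff.rfl

theorem barDifferential_comp (φ : M →ₗ[k] M') (h : ∀ a m, φ (ρ a m) = ρ' a (φ m)) {n : ℕ}
    (f : Cochain k A M n) : barDifferential ε ρ' n (φ.compMultilinearMap f) =
      φ.compMultilinearMap (barDifferential ε ρ n f) :=
  differential_compMultilinearMap φ h (fun a m => by simp) f

theorem comp_mem_cocycles (φ : M →ₗ[k] M') (h : ∀ a m, φ (ρ a m) = ρ' a (φ m)) {n : ℕ}
    {f : Cochain k A M n} (hf : f ∈ cocycles ρ.toLinearMap (augAction ε M) n) :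
    φ.compMultilinearMap f ∈ cocycles ρ'.toLinearMap (augAction ε M') n := by
  rw [mem_cocycles_bar] at hf ⊢
  rw [barDifferential_comp φ h, hf]
  ext
  simp

theorem comp_mem_coboundaries (φ : M →ₗ[k] M') (h : ∀ a m, φ (ρ a m) = ρ' a (φ m)) {n : ℕ}
    {f : Cochain k A M n} (hf : f ∈ coboundaries ρ.toLinearMap (augAction ε M) n) :
    φ.compMultilinearMap f ∈ coboundaries ρ'.toLinearMap (augAction ε M') n := by
  cases n with
  | zero =>
    rw [coboundaries, Submodule.mem_bot] at hf ⊢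
    rw [hf]
    ext
    simp
  | succ n =>
    obtain ⟨u, rfl⟩ := hf
    exact ⟨φ.compMultilinearMap u, barDifferential_comp φ h u⟩

/-- The vanishing of cohomology passes to retracts. -/
theorem CohomologyVanishes.retract {n : ℕ} (h : CohomologyVanishes ε ρ n) (i : M' →ₗ[k] M)
    (p : M →ₗ[k] M') (hi : ∀ a m, i (ρ' a m) = ρ a (i m)) (hp : ∀ a m, p (ρ a m) = ρ' a (p m))
    (hpi : ∀ m, p (i m) = m) : CohomologyVanishes ε ρ' n := by
  intro f hf
  have := comp_mem_coboundaries p hp (h (comp_mem_cocycles i hi hf))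
  convert this
  ext
  simp [hpi]

/-- Surjectivity of the map induced on cohomology by `p`. -/
def CohomologySurjective (ε : A →ₐ[k] k) (ρ : A →ₐ[k] Module.End k M)
    (ρ'' : A →ₐ[k] Module.End k M'') (p : M →ₗ[k] M'') (n : ℕ) : Prop :=
  ∀ z ∈ cocycles ρ''.toLinearMap (augAction ε M'') n,
    ∃ y ∈ cocycles ρ.toLinearMap (augAction ε M) n,
      z - p.compMultilinearMap y ∈ coboundaries ρ''.toLinearMap (augAction ε M'') n

theorem CohomologyVanishes.surjective {n : ℕ} (h : CohomologyVanishes ε ρ'' n)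
    (p : M →ₗ[k] M'') : CohomologySurjective ε ρ ρ'' p n := by
  intro z hz
  refine ⟨0, Submodule.zero_mem _, ?_⟩
  convert h hz using 1
  ext
  simp

/-- A cochain of degree `n + 1` as a cochain of degree `n` with values in linear maps. -/
noncomputable def flipCochain {n : ℕ} (F : A →ₗ[k] Cochain k A M n) :
    Cochain k A (A →ₗ[k] M) n where
  toFun a :=
    { toFun c := F c a
      map_add' c c' := by simp
      map_smul' x c := by simp }
  map_update_add' a i x y := by ext; simp
  map_update_smul' a i x y := by ext; simp

@[simp]
theorem flipCochain_apply {n : ℕ} (F : A →ₗ[k] Cochain k A M n) (a : Fin n → A) (c : A) :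
    flipCochain F a c = F c a := rfl

/-- Separating the first argument shows the differential, up to sign, as one in the remaining
arguments with values in $\mathrm{Hom}_k(A,M)$. Both $d^2=0$ and the acyclicity of coinduced modules
are read off from this form. -/
theorem differential_cons (L R : A →ₗ[k] M →ₗ[k] M) {n : ℕ} (f : Cochain k A M (n + 1)) (c : A)
    (a : Fin (n + 1) → A) : differential L R (n + 1) f (Fin.cons c a) =
      L c (f a) - f (Fin.cons (c * a 0) (Fin.tail a)) -
        (∑ i : Fin n, (-1 : k) ^ ((i : ℕ) + 1) •
          f (Fin.cons c (Fin.contractNth i.castSucc (· * ·) a)) +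
        (-1 : k) ^ (n + 1) • R (a (Fin.last n)) (f (Fin.cons c (Fin.init a)))) := by
  have e0 : Fin.contractNth (Fin.castSucc (0 : Fin (n + 1))) (· * ·)
      (Fin.cons c a : Fin (n + 2) → A) = Fin.cons (c * a 0) (Fin.tail a) := by
    funext j
    refine Fin.cases ?_ (fun j => ?_) j
    · simp [Fin.contractNth]
    · simp [Fin.contractNth, Fin.tail]
  have e1 : ∀ i : Fin n, Fin.contractNth (Fin.castSucc i.succ) (· * ·)
      (Fin.cons c a : Fin (n + 2) → A) =
        Fin.cons c (Fin.contractNth i.castSucc (· * ·) a) := by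
    intro i
    funext j
    refine Fin.cases ?_ (fun j => ?_) j
    · simp [Fin.contractNth]
    · simp only [Fin.contractNth, Fin.val_castSucc, Fin.val_succ, Fin.cons_succ,
        Nat.add_lt_add_iff_right, Nat.add_right_cancel_iff, ← Fin.succ_castSucc]
  have e2 : (Fin.init (Fin.cons c a : Fin (n + 2) → A) : Fin (n + 1) → A) =
      Fin.cons c (Fin.init a) := by
    funext j
    refine Fin.cases ?_ (fun j => ?_) j
    · simp [Fin.init]
    · simp [Fin.init]
  rw [differential_apply, Fin.sum_univ_succ, e0, e2, Fin.tail_cons, Fin.cons_zero, ← Fin.succ_last,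
    Fin.cons_succ]
  simp only [e1, Fin.val_succ, Fin.val_zero, zero_add, pow_one, neg_smul, one_smul,
    pow_succ _ (_ + 1), mul_neg, mul_one, Finset.sum_neg_distrib]
  abel

/-- Induction on the degree by moving the first argument into the coefficients, which is why `M` is
quantified inside. The actions need not be unital: the new left action on $\mathrm{Hom}_k(A,M)$ is
multiplicative but in general does not fix elements under `1`. -/
theorem differential_differential {n : ℕ} : ∀ {M : Type u} [AddCommGroup M] [Module k M]
    (L R : A →ₗ[k] M →ₗ[k] M), (∀ a b m, L (a * b) m = L a (L b m)) →
    (∀ a b m, R (a * b) m = R b (R a m)) → (∀ a b m, L a (R b m) = R b (L a m)) →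
    ∀ f : Cochain k A M n, differential L R (n + 1) (differential L R n f) = 0 := by
  induction n with
  | zero =>
    intro M _ _ L R hL hR hLR f
    ext a
    have e : ∀ b : Fin 0 → A, f b = f Fin.elim0 := fun b => congrArg f (Subsingleton.elim _ _)
    rw [differential_apply]
    simp only [differential_apply, Fin.sum_univ_zero, e]
    simp [Fin.contractNth, Fin.tail, Fin.init, hL, hR, hLR]
    abel
  | succ n ih =>
    intro M _ _ L R hL hR hLR f
    -- $(a\cdot\varphi)(c)=\varphi(ca)-c\,\varphi(a)$ is chosen to absorb, up to sign, the two terms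
    -- of the differential that involve the first argument `c` through a product.
    let L' : A →ₗ[k] (A →ₗ[k] M) →ₗ[k] (A →ₗ[k] M) :=
      LinearMap.mk₂ k (fun a φ => φ ∘ₗ LinearMap.mulRight k a - L.flip (φ a))
        (fun a b φ => by ext; simp [mul_add]; abel)
        (fun x a φ => by ext; simp [smul_sub])
        (fun a φ ψ => by ext; simp; abel)
        (fun x a φ => by ext; simp [smul_sub])
    let R' : A →ₗ[k] (A →ₗ[k] M) →ₗ[k] (A →ₗ[k] M) :=
      LinearMap.mk₂ k (fun a φ => R a ∘ₗ φ)
        (fun a b φ => by ext; simp)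
        (fun x a φ => by ext; simp)
        (fun a φ ψ => by ext; simp)
        (fun x a φ => by ext; simp)
    have hL' : ∀ a φ c, L' a φ c = φ (c * a) - L c (φ a) := fun a φ c => rfl
    have hR' : ∀ a φ c, R' a φ c = R a (φ c) := fun a φ c => rfl
    have key : ∀ {m : ℕ} (g : Cochain k A M (m + 1)),
        flipCochain (differential L R (m + 1) g).curryLeft =
          -differential L' R' m (flipCochain g.curryLeft) := by
      intro m g
      ext a c
      rw [flipCochain_apply, MultilinearMap.curryLeft_apply, differential_cons, neg_apply,
        differential_apply]
      simp [hL', hR', LinearMap.sum_apply]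
      abel
    have h1 := key (differential L R (n + 1) f)
    rw [key f, map_neg, ih L' R', neg_zero, neg_zero] at h1
    · ext a
      have := LinearMap.congr_fun (MultilinearMap.congr_fun h1 (Fin.tail a)) (a 0)
      rw [flipCochain_apply, MultilinearMap.curryLeft_apply, Fin.cons_self_tail] at this
      exact this
    · intro a b φ
      ext c
      simp [hL', hL, mul_assoc]
    · intro a b φ
      ext c
      simp [hR', hR]
    · intro a b φ
      ext c
      simp [hL', hR', hLR]

theorem barDifferential_barDifferential (n : ℕ) (f : Cochain k A M n) :
    barDifferential ε ρ (n + 1) (barDifferential ε ρ n f) = 0 :=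
  differential_differential _ _ (fun a b m => by simp) (fun a b m => by simp [smul_smul])
    (fun a b m => by simp) f

/-- The long exact sequence of `0 → M' → M → M'' → 0` at `H^(n + 1) (M')`. -/
theorem CohomologyVanishes.of_surjective {n : ℕ} (i : M' →ₗ[k] M) (p : M →ₗ[k] M'')
    (hi : ∀ a m, i (ρ' a m) = ρ a (i m)) (hp : ∀ a m, p (ρ a m) = ρ'' a (p m))
    (hinj : Function.Injective i) (hsurj : Function.Surjective p) (hex : Function.Exact i p)
    (hM : CohomologyVanishes ε ρ (n + 1)) (hs : CohomologySurjective ε ρ ρ'' p n) :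
    CohomologyVanishes ε ρ' (n + 1) := by
  intro f hf
  -- The splittings `l` and `s` are only `k`-linear; they lift cochains but do not commute with
  -- differentials.
  obtain ⟨l, hl⟩ := LinearMap.exists_leftInverse_of_injective i (LinearMap.ker_eq_bot.2 hinj)
  have hl : ∀ m, l (i m) = m := fun m => LinearMap.congr_fun hl m
  have hil : ∀ m, p m = 0 → i (l m) = m := fun m hm => by
    obtain ⟨m', rfl⟩ := (hex m).1 hm
    rw [hl]
  obtain ⟨s, hs'⟩ := LinearMap.exists_rightInverse_of_surjective p (LinearMap.range_eq_top.2 hsurj)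
  have hs' : ∀ m, p (s m) = m := fun m => LinearMap.congr_fun hs' m
  obtain ⟨u, hu⟩ := hM (comp_mem_cocycles i hi hf)
  have hpi : ∀ m, p (i m) = 0 := fun m => (hex _).2 ⟨m, rfl⟩
  -- A primitive of `i ∘ f` that is killed by `p` takes values in the image of `i`, hence descends
  -- to a primitive of `f`.
  suffices H : ∃ w : Cochain k A M n, barDifferential ε ρ n w = i.compMultilinearMap f ∧
      p.compMultilinearMap w = 0 by
    obtain ⟨w, hw, hw0⟩ := H
    have hw1 : i.compMultilinearMap (l.compMultilinearMap w) = w := by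
      ext a
      exact hil _ (MultilinearMap.congr_fun hw0 a)
    refine ⟨l.compMultilinearMap w, ?_⟩
    ext a
    apply hinj
    have h1 := barDifferential_comp (ε := ε) i hi (l.compMultilinearMap w)
    rw [hw1, hw] at h1
    exact (MultilinearMap.congr_fun h1 a).symm
  have hz : p.compMultilinearMap u ∈ cocycles ρ''.toLinearMap (augAction ε M'') n := by
    rw [mem_cocycles_bar, barDifferential_comp p hp]
    ext a
    simpa [hpi] using congrArg p (MultilinearMap.congr_fun hu a)
  obtain ⟨y, hy, hyz⟩ := hs _ hz
  rw [mem_cocycles_bar] at hy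
  cases n with
  | zero =>
    rw [coboundaries, Submodule.mem_bot] at hyz
    refine ⟨u - y, ?_, ?_⟩
    · rw [map_sub, hy, sub_zero]
      exact hu
    · rw [← hyz]
      ext
      simp
  | succ n =>
    obtain ⟨v, hv⟩ := hyz
    -- After the cocycle `y` is subtracted, `p ∘ u` is still off by the coboundary of `v`;
    -- subtracting the coboundary of a lift of `v` removes it without changing the differential.
    refine ⟨u - y - barDifferential ε ρ n (s.compMultilinearMap v), ?_, ?_⟩
    · rw [map_sub, map_sub, hy, sub_zero, barDifferential_barDifferential, sub_zero]
      exact hu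
    · have h1 := barDifferential_comp (ε := ε) p hp (s.compMultilinearMap v)
      have h2 : p.compMultilinearMap (s.compMultilinearMap v) = v := by
        ext
        simp [hs']
      rw [h2] at h1
      ext a
      have h3 := MultilinearMap.congr_fun (h1.symm.trans hv) a
      simp only [LinearMap.compMultilinearMap_apply, sub_apply, map_sub, zero_apply] at h3 ⊢
      rw [h3, sub_self]

/-- The long exact sequence of `0 → M' → M → M'' → 0` at `H^n (M'')`. -/
theorem CohomologyVanishes.cohomologySurjective {n : ℕ} (i : M' →ₗ[k] M) (p : M →ₗ[k] M'')
    (hi : ∀ a m, i (ρ' a m) = ρ a (i m)) (hp : ∀ a m, p (ρ a m) = ρ'' a (p m))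
    (hinj : Function.Injective i) (hsurj : Function.Surjective p) (hex : Function.Exact i p)
    (h : CohomologyVanishes ε ρ' (n + 1)) : CohomologySurjective ε ρ ρ'' p n := by
  intro z hz
  obtain ⟨l, hl⟩ := LinearMap.exists_leftInverse_of_injective i (LinearMap.ker_eq_bot.2 hinj)
  have hl : ∀ m, l (i m) = m := fun m => LinearMap.congr_fun hl m
  have hil : ∀ m, p m = 0 → i (l m) = m := fun m hm => by
    obtain ⟨m', rfl⟩ := (hex m).1 hm
    rw [hl]
  have hpi : ∀ m, p (i m) = 0 := fun m => (hex _).2 ⟨m, rfl⟩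
  obtain ⟨s, hs'⟩ := LinearMap.exists_rightInverse_of_surjective p (LinearMap.range_eq_top.2 hsurj)
  have hs' : ∀ m, p (s m) = m := fun m => LinearMap.congr_fun hs' m
  -- The connecting map: the differential of a lift `w` of `z` comes from a cocycle `c` with values
  -- in `M'`. As `c` is the coboundary of some `v`, correcting `w` by `i ∘ v` gives a cocycle
  -- lifting `z` exactly.
  set w := s.compMultilinearMap z with hw
  have hpw : p.compMultilinearMap w = z := by
    ext
    simp [w, hs']
  set c := l.compMultilinearMap (barDifferential ε ρ n w) with hc
  have hic : i.compMultilinearMap c = barDifferential ε ρ n w := by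
    ext a
    refine hil _ ?_
    have h1 := barDifferential_comp (ε := ε) p hp w
    rw [hpw, mem_cocycles_bar.1 hz] at h1
    exact (MultilinearMap.congr_fun h1 a).symm
  have hcc : c ∈ cocycles ρ'.toLinearMap (augAction ε M') (n + 1) := by
    rw [mem_cocycles_bar]
    ext a
    apply hinj
    have h1 := barDifferential_comp (ε := ε) i hi c
    rw [hic, barDifferential_barDifferential] at h1
    rw [zero_apply, map_zero]
    exact (MultilinearMap.congr_fun h1 a).symm
  obtain ⟨v, hv⟩ := h hcc
  refine ⟨w - i.compMultilinearMap v, ?_, ?_⟩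
  · rw [mem_cocycles_bar, map_sub, barDifferential_comp i hi, ← hic, sub_eq_zero]
    exact congrArg _ hv.symm
  · convert Submodule.zero_mem _
    ext a
    have := MultilinearMap.congr_fun hpw a
    simp only [LinearMap.compMultilinearMap_apply] at this
    simp [hpi, this]

theorem CohomologySurjective.vanishes {n : ℕ} {p : M →ₗ[k] M''}
    (hp : ∀ a m, p (ρ a m) = ρ'' a (p m)) (h : CohomologySurjective ε ρ ρ'' p n)
    (hM : CohomologyVanishes ε ρ n) : CohomologyVanishes ε ρ'' n := by
  intro z hz
  obtain ⟨y, hy, hyz⟩ := h z hz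
  have := Submodule.add_mem _ hyz (comp_mem_coboundaries p hp (hM hy))
  rwa [sub_add_cancel] at this

/-- The coinduced module `Hom_k (A, N)`. -/
noncomputable def coind (k : Type*) (A N : Type u) [Field k] [Ring A] [Algebra k A] [AddCommGroup N]
    [Module k N] : A →ₐ[k] Module.End k (A →ₗ[k] N) :=
  AlgHom.ofLinearMap
    { toFun a := LinearMap.lcomp k N (LinearMap.mulRight k a)
      map_add' a b := by ext; simp [mul_add]
      map_smul' c a := by ext; simp }
    (by ext; simp) (fun a b => by ext; simp [mul_assoc])

@[simp]
theorem coind_apply {N : Type u} [AddCommGroup N] [Module k N] (a c : A) (φ : A →ₗ[k] N) :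
    coind k A N a φ c = φ (c * a) := rfl

/-- The contracting homotopy is $(hf)(a)(c)=f(c,a)(1)$: evaluated at `1`, the cocycle identity at
$(c,a)$ has leading term $(c\cdot f(a))(1)=f(a)(c)$, and the other terms form the differential of
$hf$. -/
theorem coind_vanishes (ε : A →ₐ[k] k) (N : Type u) [AddCommGroup N] [Module k N] (n : ℕ) :
    CohomologyVanishes ε (coind k A N) (n + 1) := by
  intro f hf
  rw [mem_cocycles_bar] at hf
  let e : (A →ₗ[k] N) →ₗ[k] N := LinearMap.applyₗ 1
  refine ⟨flipCochain (e.compMultilinearMap f).curryLeft, ?_⟩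
  ext a c
  have h := LinearMap.congr_fun (MultilinearMap.congr_fun hf (Fin.cons c a)) 1
  rw [barDifferential, differential_cons] at h
  rw [differential_apply]
  simp only [LinearMap.sub_apply, LinearMap.add_apply, LinearMap.sum_apply, LinearMap.smul_apply,
    AlgHom.toLinearMap_apply, coind_apply, augAction_apply, flipCochain_apply,
    MultilinearMap.curryLeft_apply, LinearMap.compMultilinearMap_apply, zero_apply,
    LinearMap.zero_apply, one_mul, e, LinearMap.applyₗ_apply_apply] at h ⊢
  rw [sub_sub, sub_eq_zero] at h
  rw [h]
  abel

end Vanishing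

/-! ### Invariants, augmentations of tensor products, embedding into coinduced modules. -/

section Tensor

variable {k : Type*} [Field k]

theorem mem_cocycles_bar_zero {A M : Type u} [Ring A] [Algebra k A] [AddCommGroup M] [Module k M]
    {ε : A →ₐ[k] k} {ρ : A →ₐ[k] Module.End k M} {f : Cochain k A M 0} :
    f ∈ cocycles ρ.toLinearMap (augAction ε M) 0 ↔
      ∀ a, ρ a (f Fin.elim0) = ε a • f Fin.elim0 := by
  have e : ∀ b : Fin 0 → A, f b = f Fin.elim0 := fun b => congrArg f (Subsingleton.elim _ _)
  rw [mem_cocycles_bar]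
  constructor
  · intro h a
    have := MultilinearMap.congr_fun h (fun _ => a)
    rw [differential_apply] at this
    simpa [e, neg_add_eq_zero, ← sub_eq_add_neg, sub_eq_zero] using this
  · intro h
    ext a
    rw [differential_apply]
    simp [e, h]

/-- The tensor product of two augmentations. -/
noncomputable def augTensor {A B : Type*} [Ring A] [Algebra k A] [Ring B] [Algebra k B]
    (ε : A →ₐ[k] k) (ε' : B →ₐ[k] k) : A ⊗[k] B →ₐ[k] k :=
  Algebra.TensorProduct.lift ε ε' fun _ _ => Commute.all _ _

@[simp]
theorem augTensor_tmul {A B : Type*} [Ring A] [Algebra k A] [Ring B] [Algebra k B]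
    (ε : A →ₐ[k] k) (ε' : B →ₐ[k] k) (a : A) (b : B) :
    augTensor ε ε' (a ⊗ₜ b) = ε a * ε' b := by
  simp [augTensor]

/-- The trivial module of an augmented algebra. -/
noncomputable def trivialRep {A : Type*} [Ring A] [Algebra k A] (ε : A →ₐ[k] k) :
    A →ₐ[k] Module.End k k :=
  (Algebra.lmul k k).comp ε

@[simp]
theorem trivialRep_apply {A : Type*} [Ring A] [Algebra k A] (ε : A →ₐ[k] k) (a : A) (c : k) :
    trivialRep ε a c = ε a * c := rfl

/-- Every module embeds into a coinduced module. -/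
theorem exists_embedding_coind {B N : Type u} [Ring B] [Algebra k B] [AddCommGroup N] [Module k N]
    (ρ : B →ₐ[k] Module.End k N) :
    ∃ (Q : Type u) (_ : AddCommGroup Q) (_ : Module k Q) (ρQ : B →ₐ[k] Module.End k Q)
      (i : N →ₗ[k] (B →ₗ[k] N)) (p : (B →ₗ[k] N) →ₗ[k] Q),
      (∀ b m, i (ρ b m) = coind k B N b (i m)) ∧ (∀ b φ, p (coind k B N b φ) = ρQ b (p φ)) ∧
        Function.Injective i ∧ Function.Surjective p ∧ Function.Exact i p := by
  -- The unit $m\mapsto(b\mapsto bm)$ of coinduction; evaluation at `1` shows that it is injective.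
  let i : N →ₗ[k] (B →ₗ[k] N) := ρ.toLinearMap.flip
  have hi : ∀ m b, i m b = ρ b m := fun m b => rfl
  have hi' : ∀ b m, i (ρ b m) = coind k B N b (i m) := fun b m => by
    ext c
    simp [hi]
  have hW : ∀ b, LinearMap.range i ≤ (LinearMap.range i).comap (coind k B N b) := by
    rintro b _ ⟨m, rfl⟩
    exact ⟨ρ b m, hi' b m⟩
  refine ⟨_ ⧸ LinearMap.range i, inferInstance, inferInstance, AlgHom.ofLinearMap
    { toFun b := (LinearMap.range i).mapQ _ (coind k B N b) (hW b)
      map_add' b c := by ext; simp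
      map_smul' x b := by ext; simp }
    (by ext; simp) (fun b c => by ext; simp), i, (LinearMap.range i).mkQ, hi', ?_, ?_, ?_, ?_⟩
  · intro b φ
    rfl
  · intro m m' h
    simpa [hi] using LinearMap.congr_fun h 1
  · exact Submodule.mkQ_surjective _
  · exact LinearMap.exact_map_mkQ_range i

end Tensor

/-! ### The modules of tuples over a Taft algebra tensored with `B`. -/

section TaftModule

variable {k : Type u} [Field k] {n : ℕ} {ω : k} {B : Type u} [Ring B] [Algebra k B]
  {N N' : Type u} [AddCommGroup N] [Module k N] [AddCommGroup N'] [Module k N']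

/-- Equivariance can be checked on the generators of `Taft n ω ⊗ B`. -/
theorem equivariant_of_generators {ρ : Taft n ω ⊗[k] B →ₐ[k] Module.End k N}
    {ρ' : Taft n ω ⊗[k] B →ₐ[k] Module.End k N'} (φ : N →ₗ[k] N')
    (hx : ∀ v, φ (ρ (Taft.x n ω ⊗ₜ 1) v) = ρ' (Taft.x n ω ⊗ₜ 1) (φ v))
    (hg : ∀ v, φ (ρ (Taft.g n ω ⊗ₜ 1) v) = ρ' (Taft.g n ω ⊗ₜ 1) (φ v))
    (hb : ∀ b v, φ (ρ (1 ⊗ₜ b) v) = ρ' (1 ⊗ₜ b) (φ v)) (a : Taft n ω ⊗[k] B) :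
    ∀ v, φ (ρ a v) = ρ' a (φ v) := by
  induction a with
  | zero => simp
  | add a b ha hb => intro v; simp [ha, hb]
  | tmul t b =>
    have ht : ∀ v, φ (ρ (t ⊗ₜ 1) v) = ρ' (t ⊗ₜ 1) (φ v) := by
      induction t using Taft.induction with
      | halg c =>
        intro v
        have e : (algebraMap k (Taft n ω) c) ⊗ₜ[k] (1 : B) = algebraMap k _ c := rfl
        rw [e, AlgHom.commutes, AlgHom.commutes]
        simp
      | hx => exact hx
      | hg => exact hg
      | hadd a b ha hb => intro v; simp [TensorProduct.add_tmul, ha, hb]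
      | hmul a b ha hb =>
        intro v
        have e : (a * b) ⊗ₜ[k] (1 : B) = (a ⊗ₜ 1) * (b ⊗ₜ 1) := by simp
        rw [e, map_mul, map_mul, Module.End.mul_apply, Module.End.mul_apply, ha, hb]
    intro v
    have e : t ⊗ₜ[k] b = (t ⊗ₜ 1) * (1 ⊗ₜ b) := by simp
    rw [e, map_mul, map_mul, Module.End.mul_apply, Module.End.mul_apply, ht, hb]

/-- The shift operator `(v₀, …, vₘ₋₁) ↦ (v₁, …, vₘ₋₁, 0)`. -/
def shift (k : Type u) [Field k] (m : ℕ) (N : Type u) [AddCommGroup N] [Module k N] :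
    Module.End k (Fin m → N) where
  toFun v j := if h : (j : ℕ) + 1 < m then v ⟨j + 1, h⟩ else 0
  map_add' v w := by
    funext j
    by_cases h : (j : ℕ) + 1 < m <;> simp [h]
  map_smul' c v := by
    funext j
    by_cases h : (j : ℕ) + 1 < m <;> simp [h]

theorem shift_apply (m : ℕ) (v : Fin m → N) (j : Fin m) :
    shift k m N v j = if h : (j : ℕ) + 1 < m then v ⟨j + 1, h⟩ else 0 := rfl

theorem shift_pow_apply (m i : ℕ) (v : Fin m → N) (j : Fin m) :
    (shift k m N ^ i) v j = if h : (j : ℕ) + i < m then v ⟨j + i, h⟩ else 0 := by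
  induction i generalizing v with
  | zero => simp
  | succ i ih =>
    rw [pow_succ, Module.End.mul_apply, ih]
    simp only [shift_apply]
    split_ifs <;> first | omega | rfl

/-- The operator that multiplies `vⱼ` by `χ ω⁻ʲ`. -/
def weight (ω χ : k) (m : ℕ) (N : Type u) [AddCommGroup N] [Module k N] :
    Module.End k (Fin m → N) where
  toFun v j := (χ * ω⁻¹ ^ (j : ℕ)) • v j
  map_add' v w := by
    funext j
    simp
  map_smul' c v := by
    funext j
    exact smul_comm _ _ _

theorem weight_apply (ω χ : k) (m : ℕ) (v : Fin m → N) (j : Fin m) :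
    weight ω χ m N v j = (χ * ω⁻¹ ^ (j : ℕ)) • v j := rfl

theorem weight_pow_apply (ω χ : k) (m i : ℕ) (v : Fin m → N) (j : Fin m) :
    (weight ω χ m N ^ i) v j = (χ * ω⁻¹ ^ (j : ℕ)) ^ i • v j := by
  induction i generalizing v with
  | zero => simp
  | succ i ih => rw [pow_succ, Module.End.mul_apply, ih, weight_apply, smul_smul, pow_succ]

/-- The componentwise action on tuples. -/
noncomputable def tupleRep (m : ℕ) (ρ : B →ₐ[k] Module.End k N) :
    B →ₐ[k] Module.End k (Fin m → N) :=
  AlgHom.ofLinearMap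
    { toFun b := (ρ b).compLeft (Fin m)
      map_add' b c := by ext; simp
      map_smul' x b := by ext; simp }
    (by ext; simp) (fun b c => by ext; simp)

theorem tupleRep_apply (m : ℕ) (ρ : B →ₐ[k] Module.End k N) (b : B) (v : Fin m → N) (j : Fin m) :
    tupleRep m ρ b v j = ρ b (v j) := rfl

variable (hω : IsPrimitiveRoot ω n)

/-- The `Taft n ω ⊗ B`-module of `m`-tuples of elements of a `B`-module `N`, with
`x (v₀, …, vₘ₋₁) = (v₁, …, vₘ₋₁, 0)` and `(g v)ⱼ = χ ω⁻ʲ vⱼ`. -/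
noncomputable def taftRep [NeZero n] (hω : IsPrimitiveRoot ω n) {m : ℕ} (hm : m ≤ n) {χ : k}
    (hχ : χ ^ n = 1) (ρ : B →ₐ[k] Module.End k N) :
    Taft n ω ⊗[k] B →ₐ[k] Module.End k (Fin m → N) :=
  Algebra.TensorProduct.lift
    (Taft.lift (shift k m N) (weight ω χ m N)
      (by
        -- Both sides have entry $\chi\omega^{-j}v_{j+1}$ at `j`: applying the weight before the
        -- shift gives $\omega^{-j-1}$, and the factor $\omega$ of the relation makes up the
        -- difference.
        have h0 : ω ≠ 0 := hω.ne_zero (NeZero.ne n)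
        refine LinearMap.ext fun v => funext fun j => ?_
        simp only [Module.End.mul_apply, LinearMap.smul_apply, Pi.smul_apply, weight_apply,
          shift_apply]
        split_ifs
        · rw [smul_smul, pow_succ]
          congr 1
          field_simp
        · simp)
      (by
        refine LinearMap.ext fun v => funext fun j => ?_
        rw [shift_pow_apply, dif_neg (by omega)]
        rfl)
      (by
        refine LinearMap.ext fun v => funext fun j => ?_
        rw [weight_pow_apply, mul_pow, hχ, ← pow_mul, mul_comm (j : ℕ), pow_mul, inv_pow,
          hω.pow_eq_one]
        simp))
    (tupleRep m ρ)
    (fun t b => by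
      induction t using Taft.induction with
      | halg c => rw [AlgHom.commutes]; exact Algebra.commute_algebraMap_left _ _
      | hx =>
        rw [Taft.lift_x]
        refine LinearMap.ext fun v => funext fun j => ?_
        simp only [Module.End.mul_apply, shift_apply, tupleRep_apply]
        split_ifs <;> simp
      | hg =>
        rw [Taft.lift_g]
        refine LinearMap.ext fun v => funext fun j => ?_
        simp [Module.End.mul_apply, weight_apply, tupleRep_apply]
      | hadd a b ha hb => rw [map_add]; exact ha.add_left hb
      | hmul a b ha hb => rw [map_mul]; exact ha.mul_left hb)

section Rep

variable [NeZero n] {m : ℕ} (hm : m ≤ n) {χ : k} (hχ : χ ^ n = 1) (ρ : B →ₐ[k] Module.End k N)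

theorem taftRep_x (v : Fin m → N) :
    taftRep hω hm hχ ρ (Taft.x n ω ⊗ₜ 1) v = shift k m N v := by
  simp [taftRep, Taft.lift_x]

theorem taftRep_g (v : Fin m → N) :
    taftRep hω hm hχ ρ (Taft.g n ω ⊗ₜ 1) v = weight ω χ m N v := by
  simp [taftRep, Taft.lift_g]

theorem taftRep_tmul (b : B) (v : Fin m → N) :
    taftRep hω hm hχ ρ (1 ⊗ₜ b) v = tupleRep m ρ b v := by
  simp [taftRep]

/-- Functoriality in the `B`-module. With `exact_compLeft` it lets short exact sequences of
`B`-modules be used for dimension shifting over the tensor product. -/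
theorem taftRep_compLeft {ρ : B →ₐ[k] Module.End k N} {ρ' : B →ₐ[k] Module.End k N'}
    (φ : N →ₗ[k] N') (h : ∀ b v, φ (ρ b v) = ρ' b (φ v)) (a : Taft n ω ⊗[k] B) :
    ∀ v, φ.compLeft (Fin m) (taftRep hω hm hχ ρ a v) =
      taftRep hω hm hχ ρ' a (φ.compLeft (Fin m) v) := by
  refine equivariant_of_generators _ ?_ ?_ ?_ a
  · intro v
    funext j
    simp only [taftRep_x, LinearMap.compLeft_apply, Function.comp_apply, shift_apply]
    split_ifs <;> simp
  · intro v
    funext j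
    simp [taftRep_g, weight_apply]
  · intro b v
    funext j
    simp [taftRep_tmul, tupleRep_apply, h]

theorem exact_compLeft {N'' : Type u} [AddCommGroup N''] [Module k N''] {i : N →ₗ[k] N'}
    {p : N' →ₗ[k] N''} (h : Function.Exact i p) (m : ℕ) :
    Function.Exact (i.compLeft (Fin m)) (p.compLeft (Fin m)) := by
  intro v
  constructor
  · intro hv
    choose w hw using fun j => (h (v j)).1 (congrFun hv j)
    exact ⟨w, funext hw⟩
  · rintro ⟨w, rfl⟩
    funext j
    exact (h _).2 ⟨w j, rfl⟩

/-- The degree zero cohomology of the modules `taftRep`. -/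
theorem taftRep_invariant_iff (ε : B →ₐ[k] k) (v : Fin m → N) (hm0 : 0 < m) :
    (∀ a, taftRep hω hm hχ ρ a v = augTensor Taft.counitHom ε a • v) ↔
      (∀ j : Fin m, (j : ℕ) ≠ 0 → v j = 0) ∧ χ • v ⟨0, hm0⟩ = v ⟨0, hm0⟩ ∧
        ∀ b, ρ b (v ⟨0, hm0⟩) = ε b • v ⟨0, hm0⟩ := by
  constructor
  · intro h
    refine ⟨fun j hj => ?_, ?_, fun b => ?_⟩
    -- Entry `j - 1` of `x v = 0` is the statement `v j = 0`.
    · have := congrFun (h (Taft.x n ω ⊗ₜ 1)) ⟨j - 1, by omega⟩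
      rw [taftRep_x, shift_apply, dif_pos (by simp only; omega)] at this
      simp only [augTensor_tmul, Taft.counitHom_x, zero_mul, zero_smul, Pi.zero_apply] at this
      rw [← this]
      congr 1
      ext
      simp only
      omega
    · have := congrFun (h (Taft.g n ω ⊗ₜ 1)) ⟨0, hm0⟩
      simpa [taftRep_g, weight_apply, Taft.counitHom_g] using this
    · have := congrFun (h (1 ⊗ₜ b)) ⟨0, hm0⟩
      simpa [taftRep_tmul, tupleRep_apply] using this
  · rintro ⟨h1, h2, h3⟩ a
    -- Invariance of `v` is equivariance of $c\mapsto cv$ on the trivial module, so it can be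
    -- checked on generators.
    have key := equivariant_of_generators (ρ := trivialRep (augTensor Taft.counitHom ε))
      (ρ' := taftRep hω hm hχ ρ) (LinearMap.toSpanSingleton k _ v) ?_ ?_ ?_ a 1
    · simpa using key.symm
    · intro c
      simp only [trivialRep_apply, augTensor_tmul, Taft.counitHom_x, zero_mul, map_zero,
        LinearMap.toSpanSingleton_apply, map_smul, taftRep_x]
      funext j
      by_cases hj : (j : ℕ) + 1 < m
      · simp [shift_apply, hj, h1]
      · simp [shift_apply, hj]
    · intro c
      simp only [trivialRep_apply, augTensor_tmul, Taft.counitHom_g, map_one, one_mul, mul_one,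
        LinearMap.toSpanSingleton_apply, map_smul, taftRep_g]
      congr 1
      funext j
      rw [weight_apply]
      by_cases hj : (j : ℕ) = 0
      · obtain rfl : j = ⟨0, hm0⟩ := Fin.ext hj
        simp [h2]
      · simp [h1 j hj]
    · intro b c
      simp only [trivialRep_apply, augTensor_tmul, map_one, one_mul,
        LinearMap.toSpanSingleton_apply, map_smul, taftRep_tmul, mul_comm _ c, mul_smul]
      congr 1
      funext j
      rw [tupleRep_apply]
      by_cases hj : (j : ℕ) = 0
      · obtain rfl : j = ⟨0, hm0⟩ := Fin.ext hj
        simp [h3]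
      · simp [h1 j hj]

end Rep

end TaftModule

/-! ### Odd vanishing passes from `B` to the tensor product with a Taft algebra. -/

section TaftVanishing

variable {k : Type u} [Field k] {n : ℕ} {ω : k} {B : Type u} [Ring B] [Algebra k B]
  {N N' : Type u} [AddCommGroup N] [Module k N] [AddCommGroup N'] [Module k N'] [NeZero n]

theorem taft_x_pow_mul_g (hω : IsPrimitiveRoot ω n) (j : ℕ) :
    Taft.x n ω ^ j * Taft.g n ω = ω⁻¹ ^ j • (Taft.g n ω * Taft.x n ω ^ j) := by
  have h0 : ω ≠ 0 := hω.ne_zero (NeZero.ne n)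
  induction j with
  | zero => simp
  | succ j ih =>
    have e : Taft.x n ω * Taft.g n ω = ω⁻¹ • (Taft.g n ω * Taft.x n ω) := by
      rw [Taft.g_mul_x, smul_smul, inv_mul_cancel₀ h0, one_smul]
    rw [pow_succ, mul_assoc, e, mul_smul_comm, ← mul_assoc, ih, smul_mul_assoc, smul_smul,
      mul_assoc, pow_succ, mul_comm ω⁻¹]

/-- The modules induced from coinduced `B`-modules are acyclic, being retracts of coinduced
modules. -/
theorem taftRep_coind_vanishes (hω : IsPrimitiveRoot ω n) {χ : k} (hχ : χ ^ n = 1)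
    (ε : Taft n ω ⊗[k] B →ₐ[k] k) (N : Type u) [AddCommGroup N] [Module k N] (i : ℕ) :
    CohomologyVanishes ε (taftRep hω le_rfl hχ (coind k B N)) (i + 1) := by
  -- A field with a primitive `n`-th root of unity has `n` invertible, which the average over the
  -- powers of `g` requires.
  have hn0 : (n : k) ≠ 0 := hω.neZero'.out
  have hχ0 : χ ≠ 0 := by
    rintro rfl
    simp [NeZero.ne n] at hχ
  let ρ := taftRep hω le_rfl hχ (coind k B N)
  let e : (Fin n → (B →ₗ[k] N)) →ₗ[k] N := LinearMap.applyₗ (1 : B) ∘ₗ LinearMap.proj 0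
  -- `I` identifies the tuples with the functions $\varphi$ on $T\otimes B$ satisfying
  -- $\varphi(ga)=\chi\varphi(a)$, where $v_j(b)=\varphi(x^j\otimes b)$.
  let I : (Fin n → (B →ₗ[k] N)) →ₗ[k] (Taft n ω ⊗[k] B →ₗ[k] N) :=
    { toFun v := e ∘ₗ ρ.toLinearMap.flip v
      map_add' v w := by ext; simp
      map_smul' c v := by ext; simp }
  have hI : ∀ v a, I v a = ρ a v 0 1 := fun v a => rfl
  -- Projection onto the $\chi$-eigenspace for left translation by `g`, read in the coordinates
  -- $x^j\otimes b$.
  let P : (Taft n ω ⊗[k] B →ₗ[k] N) →ₗ[k] (Fin n → (B →ₗ[k] N)) :=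
    { toFun φ j := (n : k)⁻¹ • ∑ s ∈ Finset.range n, χ⁻¹ ^ s •
        (φ ∘ₗ TensorProduct.mk k (Taft n ω) B (Taft.g n ω ^ s * Taft.x n ω ^ (j : ℕ)))
      map_add' φ ψ := by
        funext j
        simp [LinearMap.add_comp, Finset.sum_add_distrib]
      map_smul' c φ := by
        funext j
        simp only [LinearMap.smul_comp, Pi.smul_apply, RingHom.id_apply, Finset.smul_sum]
        refine Finset.sum_congr rfl fun s _ => ?_
        rw [smul_comm _ c, smul_comm _ c] }
  have hP : ∀ φ j b, P φ j b = (n : k)⁻¹ • ∑ s ∈ Finset.range n, χ⁻¹ ^ s •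
      φ ((Taft.g n ω ^ s * Taft.x n ω ^ (j : ℕ)) ⊗ₜ b) := fun φ j b => by
    simp [P, LinearMap.sum_apply]
  refine (coind_vanishes ε N i).retract I P ?_ ?_ ?_
  · intro a v
    refine LinearMap.ext fun c => ?_
    rw [hI, coind_apply, hI, map_mul]
    rfl
  · intro a
    refine equivariant_of_generators P ?_ ?_ ?_ a
    · intro φ
      refine funext fun j => LinearMap.ext fun b => ?_
      rw [taftRep_x, shift_apply]
      have e1 : ∀ s, (Taft.g n ω ^ s * Taft.x n ω ^ (j : ℕ)) * Taft.x n ω =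
          Taft.g n ω ^ s * Taft.x n ω ^ ((j : ℕ) + 1) := fun s => by rw [mul_assoc, pow_succ]
      simp only [hP, coind_apply, Algebra.TensorProduct.tmul_mul_tmul, e1, mul_one]
      split_ifs with h
      · rw [hP]
      -- At the last coordinate both sides are zero, the averaged one because `x ^ n = 0`.
      · have : (j : ℕ) + 1 = n := by omega
        simp [this, Taft.x_pow]
    · intro φ
      refine funext fun j => LinearMap.ext fun b => ?_
      rw [taftRep_g, weight_apply, LinearMap.smul_apply, hP, hP]
      -- Right multiplication by `g` shifts the index of summation at the cost of the weight. The
      -- sum is cyclic, `F n = F 0`, because $g^n=1$ and $\chi^n=1$.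
      let F : ℕ → N := fun s => χ⁻¹ ^ s • φ ((Taft.g n ω ^ s * Taft.x n ω ^ (j : ℕ)) ⊗ₜ b)
      have e1 : ∀ s, χ⁻¹ ^ s • coind k (Taft n ω ⊗[k] B) N (Taft.g n ω ⊗ₜ 1) φ
          ((Taft.g n ω ^ s * Taft.x n ω ^ (j : ℕ)) ⊗ₜ b) = (χ * ω⁻¹ ^ (j : ℕ)) • F (s + 1) := by
        intro s
        rw [coind_apply, Algebra.TensorProduct.tmul_mul_tmul, mul_one, mul_assoc,
          taft_x_pow_mul_g hω, mul_smul_comm, ← mul_assoc, ← pow_succ, ← TensorProduct.smul_tmul',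
          map_smul, smul_smul, smul_smul]
        congr 1
        rw [pow_succ]
        field_simp
      have e2 : F n = F 0 := by simp [F, Taft.g_pow, hχ]
      have e3 : ∑ s ∈ Finset.range n, F (s + 1) = ∑ s ∈ Finset.range n, F s := by
        have := Finset.sum_range_succ' F n
        rw [Finset.sum_range_succ, e2] at this
        exact (add_right_cancel this).symm
      simp only [e1]
      rw [← Finset.smul_sum, e3, smul_comm]
    · intro b φ
      refine funext fun j => LinearMap.ext fun c => ?_
      rw [taftRep_tmul, tupleRep_apply, coind_apply, hP, hP]
      simp [coind_apply]
  · intro v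
    refine funext fun j => LinearMap.ext fun b => ?_
    rw [hP]
    -- Every summand of the average is the same: $x^j$ brings coordinate `j` to position `0`, where
    -- $g^s$ acts by $\chi^s$.
    have e1 : ∀ s, χ⁻¹ ^ s • I v ((Taft.g n ω ^ s * Taft.x n ω ^ (j : ℕ)) ⊗ₜ b) = v j b := by
      intro s
      have e2 : (Taft.g n ω ^ s * Taft.x n ω ^ (j : ℕ)) ⊗ₜ[k] b =
          (Taft.g n ω ⊗ₜ 1) ^ s * (Taft.x n ω ⊗ₜ 1) ^ (j : ℕ) * (1 ⊗ₜ b) := by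
        simp [Algebra.TensorProduct.tmul_pow]
      have e3 : ρ (Taft.g n ω ⊗ₜ 1) = weight ω χ n (B →ₗ[k] N) :=
        LinearMap.ext fun v => taftRep_g ..
      have e4 : ρ (Taft.x n ω ⊗ₜ 1) = shift k n (B →ₗ[k] N) := LinearMap.ext fun v => taftRep_x ..
      have e5 : ρ (1 ⊗ₜ b) = tupleRep n (coind k B N) b := LinearMap.ext fun v => taftRep_tmul ..
      rw [hI, e2, map_mul, map_mul, map_pow, map_pow, e3, e4, e5, Module.End.mul_apply,
        Module.End.mul_apply, weight_pow_apply, shift_pow_apply, dif_pos (by simp)]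
      simp [tupleRep_apply, smul_smul, hχ0]
    simp only [e1, Finset.sum_const, Finset.card_range, ← Nat.cast_smul_eq_nsmul k, smul_smul,
      inv_mul_cancel₀ hn0, one_smul]

/-- An invariant vector is killed by `x`, hence lies in coordinate `0`, where `g` acts by $\chi\ne1$
and yet must act trivially. -/
theorem taftRep_vanishes_zero (hω : IsPrimitiveRoot ω n) {m : ℕ} (hm : m ≤ n) {χ : k}
    (hχ : χ ^ n = 1) (hχ1 : χ ≠ 1) (ρ : B →ₐ[k] Module.End k N) (ε : B →ₐ[k] k) :
    CohomologyVanishes (augTensor Taft.counitHom ε) (taftRep hω hm hχ ρ) 0 := by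
  intro f hf
  rw [mem_cocycles_bar_zero] at hf
  rw [coboundaries, Submodule.mem_bot]
  ext a j
  rw [Subsingleton.elim a Fin.elim0]
  have h := (taftRep_invariant_iff hω hm hχ ρ ε _ (j.pos)).1 hf
  by_cases hj : (j : ℕ) = 0
  · have h1 : (χ - 1) • f Fin.elim0 ⟨0, j.pos⟩ = 0 := by rw [sub_smul, one_smul, h.2.1, sub_self]
    rw [show j = ⟨0, j.pos⟩ from Fin.ext hj]
    exact (smul_eq_zero.1 h1).resolve_left (sub_ne_zero.2 hχ1)
  · exact h.1 j hj

/-- Dimension shifting in `N`: tuples over a coinduced module are acyclic, so degree `i + 1` for `N`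
reduces to degree `i` for the quotient of the coinduced module by `N`. This is why `N` varies in the
induction, which ends at the invariants. -/
theorem taftRep_vanishes_of_ne_one (hω : IsPrimitiveRoot ω n) {χ : k} (hχ : χ ^ n = 1)
    (hχ1 : χ ≠ 1) (ε : B →ₐ[k] k) (i : ℕ) : ∀ {N : Type u} [AddCommGroup N] [Module k N]
    (ρ : B →ₐ[k] Module.End k N),
    CohomologyVanishes (augTensor Taft.counitHom ε) (taftRep hω le_rfl hχ ρ) i := by
  induction i with
  | zero =>
    intro N _ _ ρ
    exact taftRep_vanishes_zero hω le_rfl hχ hχ1 ρ ε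
  | succ i ih =>
    intro N _ _ ρ
    obtain ⟨Q, _, _, ρQ, ι, π, hι, hπ, hinj, hsurj, hex⟩ := exists_embedding_coind ρ
    exact CohomologyVanishes.of_surjective (ι.compLeft (Fin n)) (π.compLeft (Fin n))
      (taftRep_compLeft hω le_rfl hχ ι hι) (taftRep_compLeft hω le_rfl hχ π hπ)
      hinj.comp_left hsurj.comp_left (exact_compLeft hex n)
      (taftRep_coind_vanishes hω hχ _ N i) ((ih ρQ).surjective _)

/-- For $\chi=1$ the invariant tuples are exactly the invariants of the `B`-module placed in
coordinate `0`, so lifting them is the same problem over `B`. -/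
theorem taftRep_surjective_zero (hω : IsPrimitiveRoot ω n) (ε : B →ₐ[k] k)
    {ρ : B →ₐ[k] Module.End k N} {ρ' : B →ₐ[k] Module.End k N'} (p : N →ₗ[k] N')
    (h : CohomologySurjective ε ρ ρ' p 0) :
    CohomologySurjective (augTensor Taft.counitHom ε) (taftRep hω le_rfl (one_pow n) ρ)
      (taftRep hω le_rfl (one_pow n) ρ') (p.compLeft (Fin n)) 0 := by
  intro z hz
  rw [mem_cocycles_bar_zero] at hz
  have hn : 0 < n := NeZero.pos n
  obtain ⟨h1, -, h3⟩ := (taftRep_invariant_iff hω le_rfl _ ρ' ε _ hn).1 hz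
  obtain ⟨y, hy, hyz⟩ := h (MultilinearMap.constOfIsEmpty k _ (z Fin.elim0 ⟨0, hn⟩))
    (mem_cocycles_bar_zero.2 h3)
  rw [mem_cocycles_bar_zero] at hy
  rw [coboundaries, Submodule.mem_bot] at hyz
  have hyz : z Fin.elim0 ⟨0, hn⟩ = p (y Fin.elim0) := by
    simpa [sub_eq_zero] using MultilinearMap.congr_fun hyz Fin.elim0
  refine ⟨MultilinearMap.constOfIsEmpty k _ (Pi.single ⟨0, hn⟩ (y Fin.elim0)), ?_, ?_⟩
  · rw [mem_cocycles_bar_zero]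
    refine (taftRep_invariant_iff hω le_rfl _ ρ ε _ hn).2 ⟨fun j hj => ?_, ?_, ?_⟩
    · exact Pi.single_eq_of_ne (fun h => hj (by rw [h])) _
    · simp
    · simpa using hy
  · rw [coboundaries, Submodule.mem_bot]
    ext a j
    rw [Subsingleton.elim a Fin.elim0]
    change z Fin.elim0 j - p ((Pi.single ⟨0, hn⟩ (y Fin.elim0) : Fin n → N) j) = 0
    by_cases hj : (j : ℕ) = 0
    · obtain rfl : j = ⟨0, hn⟩ := Fin.ext hj
      rw [Pi.single_eq_same, hyz, sub_self]
    · rw [Pi.single_eq_of_ne (fun h => hj (by rw [h])), h1 j hj, map_zero, sub_zero]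

/-- A form of Shapiro's lemma, by dimension shifting in `N`. Degree one is special: invariants need
not vanish when $\chi=1$, so the argument transfers surjectivity in degree zero instead. In higher
degrees vanishing for `N` gives vanishing for the quotient one degree lower. -/
theorem taftRep_vanishes (hω : IsPrimitiveRoot ω n) (ε : B →ₐ[k] k) (i : ℕ) :
    ∀ {N : Type u} [AddCommGroup N] [Module k N] {ρ : B →ₐ[k] Module.End k N},
    CohomologyVanishes ε ρ (i + 1) →
    CohomologyVanishes (augTensor Taft.counitHom ε) (taftRep hω le_rfl (one_pow n) ρ) (i + 1) := by
  induction i with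
  | zero =>
    intro N _ _ ρ h
    obtain ⟨Q, _, _, ρQ, ι, π, hι, hπ, hinj, hsurj, hex⟩ := exists_embedding_coind ρ
    exact CohomologyVanishes.of_surjective (ι.compLeft (Fin n)) (π.compLeft (Fin n))
      (taftRep_compLeft hω le_rfl _ ι hι) (taftRep_compLeft hω le_rfl _ π hπ)
      hinj.comp_left hsurj.comp_left (exact_compLeft hex n)
      (taftRep_coind_vanishes hω _ _ N 0)
      (taftRep_surjective_zero hω ε π (h.cohomologySurjective ι π hι hπ hinj hsurj hex))
  | succ i ih =>
    intro N _ _ ρ h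
    obtain ⟨Q, _, _, ρQ, ι, π, hι, hπ, hinj, hsurj, hex⟩ := exists_embedding_coind ρ
    have hQ : CohomologyVanishes ε ρQ (i + 1) :=
      (h.cohomologySurjective ι π hι hπ hinj hsurj hex).vanishes hπ (coind_vanishes ε N i)
    exact CohomologyVanishes.of_surjective (ι.compLeft (Fin n)) (π.compLeft (Fin n))
      (taftRep_compLeft hω le_rfl _ ι hι) (taftRep_compLeft hω le_rfl _ π hπ)
      hinj.comp_left hsurj.comp_left (exact_compLeft hex n)
      (taftRep_coind_vanishes hω _ _ N (i + 1)) ((ih hQ).surjective _)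

/-- The submodule `taftRep` of length `m` in the one of length `m + l`, with quotient of
length `l`. -/
theorem exists_taftRep_exact (hω : IsPrimitiveRoot ω n) {m l t : ℕ} (h : m + l = t) (hm : m ≤ n)
    (hl : l ≤ n) (ht : t ≤ n) {χ χ' : k} (hχ : χ ^ n = 1) (hχ' : χ' ^ n = 1)
    (e : χ' = χ * ω⁻¹ ^ m) (ρ : B →ₐ[k] Module.End k N) :
    ∃ (i : (Fin m → N) →ₗ[k] (Fin t → N)) (p : (Fin t → N) →ₗ[k] (Fin l → N)),
      (∀ a v, i (taftRep hω hm hχ ρ a v) = taftRep hω ht hχ ρ a (i v)) ∧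
      (∀ a v, p (taftRep hω ht hχ ρ a v) = taftRep hω hl hχ' ρ a (p v)) ∧
        Function.Injective i ∧ Function.Surjective p ∧ Function.Exact i p := by
  let i : (Fin m → N) →ₗ[k] (Fin t → N) :=
    { toFun v j := if h : (j : ℕ) < m then v ⟨j, h⟩ else 0
      map_add' v w := by
        funext j
        by_cases h : (j : ℕ) < m <;> simp [h]
      map_smul' c v := by
        funext j
        by_cases h : (j : ℕ) < m <;> simp [h] }
  have hi : ∀ v j, i v j = if h : (j : ℕ) < m then v ⟨j, h⟩ else 0 := fun v j => rfl
  let p : (Fin t → N) →ₗ[k] (Fin l → N) := LinearMap.funLeft k N (fun j => ⟨m + j, by omega⟩)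
  have hp : ∀ v j, p v j = v ⟨m + j, by omega⟩ := fun v j => rfl
  refine ⟨i, p, fun a => ?_, fun a => ?_, ?_, ?_, ?_⟩
  · refine equivariant_of_generators i (fun v => funext fun j => ?_) (fun v => funext fun j => ?_)
      (fun b v => funext fun j => ?_) a
    · simp only [taftRep_x, hi, shift_apply]
      split_ifs <;> first | omega | rfl
    · simp only [taftRep_g, hi, weight_apply]
      split_ifs <;> simp
    · simp only [taftRep_tmul, hi, tupleRep_apply]
      split_ifs <;> simp
  · refine equivariant_of_generators p (fun v => funext fun j => ?_) (fun v => funext fun j => ?_)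
      (fun b v => funext fun j => ?_) a
    · simp only [taftRep_x, hp, shift_apply]
      split_ifs <;> first | omega | rfl
    · simp only [taftRep_g, hp, weight_apply]
      -- Coordinate `j` of the quotient is coordinate `m + j`, so its weights start at
      -- $\chi\omega^{-m}$.
      rw [e, mul_assoc, ← pow_add]
    · simp only [taftRep_tmul, hp, tupleRep_apply]
  · intro v w hvw
    funext j
    have := congrFun hvw ⟨j, by omega⟩
    simpa [hi] using this
  · intro w
    refine ⟨fun j => if hj : m ≤ (j : ℕ) then w ⟨j - m, by omega⟩ else 0, ?_⟩
    funext j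
    simp [hp]
  · intro v
    constructor
    · intro hv
      refine ⟨fun j => v ⟨j, by omega⟩, ?_⟩
      funext j
      rw [hi]
      split_ifs with hj
      · rfl
      · have := congrFun hv ⟨j - m, by omega⟩
        rw [hp, Pi.zero_apply] at this
        rw [← this]
        congr 1
        ext
        simp only
        omega
    · rintro ⟨w, rfl⟩
      funext j
      rw [hp, hi, dif_neg (by simp)]
      rfl

/-- With $n=l+1$, the length-`l` module with character $\omega^{-1}$ is both the quotient of
$M_n(1)$ by $M_1(1)$ and the kernel of $M_n(\omega^{-1})\to M_1(1)$. The two long exact sequences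
advance the vanishing by two degrees; the hypothesis on `B` enters through $M_n(1)$ in odd degrees
only. -/
theorem taftRep_one_vanishes (hω : IsPrimitiveRoot ω n) (ε : B →ₐ[k] k)
    (ρ : B →ₐ[k] Module.End k N) (h : ∀ i, CohomologyVanishes ε ρ (2 * i + 1)) (i : ℕ) :
    CohomologyVanishes (augTensor Taft.counitHom ε)
      (taftRep hω NeZero.one_le (one_pow n) ρ) (2 * i + 1) := by
  obtain ⟨l, rfl⟩ : ∃ l, n = l + 1 := ⟨n - 1, by have := NeZero.pos n; omega⟩
  -- For $n=1$ the one-tuples are already the full-length module, and $\omega=1$ offers no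
  -- nontrivial character.
  rcases Nat.eq_zero_or_pos l with rfl | hl
  · exact taftRep_vanishes hω ε _ (h i)
  have hω1 : ω ≠ 1 := hω.ne_one (by omega)
  have hω0 : ω ≠ 0 := hω.ne_zero (NeZero.ne _)
  have hχ : ω⁻¹ ^ (l + 1) = 1 := by rw [inv_pow, hω.pow_eq_one, inv_one]
  have hχ1 : ω⁻¹ ≠ 1 := fun h => hω1 (inv_eq_one.1 h)
  obtain ⟨i₁, p₁, hi₁, hp₁, hinj₁, hsurj₁, hex₁⟩ := exists_taftRep_exact hω (add_comm 1 l)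
    NeZero.one_le (Nat.le_succ l) le_rfl (one_pow _) hχ (by simp) ρ
  obtain ⟨i₂, p₂, hi₂, hp₂, hinj₂, hsurj₂, hex₂⟩ := exists_taftRep_exact hω (rfl : l + 1 = l + 1)
    (Nat.le_succ l) NeZero.one_le le_rfl hχ (one_pow _) (by rw [← pow_succ', hχ]) ρ
  -- The sequence with middle term $M_n(1)$: vanishing in degree `2 * i` for length `l` gives
  -- vanishing in degree `2 * i + 1` for length one.
  have key : ∀ i, CohomologyVanishes (augTensor Taft.counitHom ε)
      (taftRep hω (Nat.le_succ l) hχ ρ) (2 * i) →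
        CohomologyVanishes (augTensor Taft.counitHom ε)
          (taftRep hω NeZero.one_le (one_pow _) ρ) (2 * i + 1) := fun i hi =>
    CohomologyVanishes.of_surjective i₁ p₁ hi₁ hp₁ hinj₁ hsurj₁ hex₁
      (taftRep_vanishes hω ε _ (h i)) (hi.surjective p₁)
  induction i with
  | zero => exact key 0 (taftRep_vanishes_zero hω _ hχ hχ1 ρ ε)
  | succ i ih =>
    -- The sequence whose middle term $M_n(\omega^{-1})$ has no cohomology at all takes degree `2 *
    -- i + 1` for length one to degree `2 * i + 2` for length `l`.
    exact key (i + 1) (CohomologyVanishes.of_surjective i₂ p₂ hi₂ hp₂ hinj₂ hsurj₂ hex₂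
      (taftRep_vanishes_of_ne_one hω hχ hχ1 ε _ ρ) (ih.surjective p₂))

/-- If the odd cohomology of `B` vanishes, then so does the odd cohomology of `Taft n ω ⊗ B`. -/
theorem taft_tensor_vanishes (hω : IsPrimitiveRoot ω n) (ε : B →ₐ[k] k)
    (h : ∀ i, CohomologyVanishes ε (trivialRep ε) (2 * i + 1)) (i : ℕ) :
    CohomologyVanishes (augTensor (Taft.counitHom (n := n) (ω := ω)) ε)
      (trivialRep (augTensor Taft.counitHom ε)) (2 * i + 1) := by
  have H := taftRep_one_vanishes hω ε _ h i
  -- One-tuples over the trivial `B`-module with $\chi=1$ form the trivial module: the shift is zero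
  -- and the only weight is one.
  have hS : ∀ a v, LinearEquiv.funUnique (Fin 1) k k
      (taftRep hω NeZero.one_le (one_pow n) (trivialRep ε) a v) =
        trivialRep (augTensor Taft.counitHom ε) a (LinearEquiv.funUnique (Fin 1) k k v) := by
    intro a
    refine equivariant_of_generators (LinearEquiv.funUnique (Fin 1) k k).toLinearMap ?_ ?_ ?_ a
    · intro v
      simp [taftRep_x, shift_apply, Taft.counitHom_x]
    · intro v
      simp [taftRep_g, weight_apply, Taft.counitHom_g]
    · intro b v
      simp [taftRep_tmul, tupleRep_apply]
  refine H.retract (LinearEquiv.funUnique (Fin 1) k k).symm.toLinearMap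
    (LinearEquiv.funUnique (Fin 1) k k).toLinearMap (fun a c => ?_) hS (by simp)
  refine (LinearEquiv.funUnique (Fin 1) k k).injective ?_
  have := hS a ((LinearEquiv.funUnique (Fin 1) k k).symm c)
  simp only [LinearEquiv.apply_symm_apply, LinearEquiv.coe_coe] at this ⊢
  exact this.symm

end TaftVanishing

/-! ### Odd vanishing for quantum elementary abelian groups, and the range of the bracket. -/

section OddVanishing

variable {k : Type u} [Field k]

/-- The vanishing of the odd cohomology of an augmented algebra with trivial coefficients. -/
def OddVanishing {A : Type u} [Ring A] [Algebra k A] (ε : A →ₐ[k] k) : Prop :=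
  ∀ i, CohomologyVanishes ε (trivialRep ε) (2 * i + 1)

theorem barDifferential_compLinearMap {A B : Type u} [Ring A] [Algebra k A] [Ring B] [Algebra k B]
    {ε : A →ₐ[k] k} {ε' : B →ₐ[k] k} (φ : A →ₐ[k] B) (h : ε'.comp φ = ε) {n : ℕ}
    (f : Cochain k B k n) :
    barDifferential ε (trivialRep ε) n (f.compLinearMap fun _ => φ.toLinearMap) =
      (barDifferential ε' (trivialRep ε') n f).compLinearMap fun _ => φ.toLinearMap := by
  subst h
  exact differential_compLinearMap φ (trivialRep ε').toLinearMap (augAction ε' k) f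

theorem OddVanishing.equiv {A B : Type u} [Ring A] [Algebra k A] [Ring B] [Algebra k B]
    {ε : A →ₐ[k] k} {ε' : B →ₐ[k] k} (hA : OddVanishing ε) (e : A ≃ₐ[k] B)
    (h : ε'.comp e.toAlgHom = ε) : OddVanishing ε' := by
  have h' : ε.comp e.symm.toAlgHom = ε' := by
    subst h
    ext b
    simp
  intro i f hf
  rw [mem_cocycles_bar] at hf
  have h1 := barDifferential_compLinearMap e.toAlgHom h f
  rw [hf] at h1
  obtain ⟨u, hu⟩ := hA i (x := f.compLinearMap fun _ => e.toAlgHom.toLinearMap) h1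
  refine ⟨u.compLinearMap fun _ => e.symm.toAlgHom.toLinearMap, ?_⟩
  refine (barDifferential_compLinearMap e.symm.toAlgHom h' u).trans ?_
  refine (congrArg (fun F => MultilinearMap.compLinearMap F
    fun _ => e.symm.toAlgHom.toLinearMap) hu).trans ?_
  ext a
  simp

/-- Over `k` itself, the trivial module is a retract of the coinduced module $\mathrm{Hom}_k(k,k)$.
-/
theorem oddVanishing_self : OddVanishing (AlgHom.id k k) := by
  intro i
  refine (coind_vanishes (AlgHom.id k k) k (2 * i)).retract (LinearMap.mul k k).flip
    (LinearMap.applyₗ 1) (fun a c => ?_) (fun a φ => ?_) (by simp)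
  · ext
    simp [mul_comm]
  · simpa using φ.map_smul a 1

/-- Tensoring with a quantum elementary abelian group preserves the vanishing of the odd
cohomology. -/
theorem IsQuantumElementaryAbelian.oddVanishing_tensor {A : Type u} [Ring A] [HopfAlgebra k A]
    (hA : IsQuantumElementaryAbelian k A) : ∀ {B : Type u} [Ring B] [Algebra k B] (ε : B →ₐ[k] k),
      OddVanishing ε → OddVanishing (augTensor (Bialgebra.counitAlgHom k A) ε) := by
  induction hA with
  | taft n ω =>
    intro B _ _ ε h
    exact taft_tensor_vanishes Fact.out ε h
  | tensor A A' _ _ ihA ihA' =>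
    intro B _ _ ε h
    -- Because `B` is arbitrary, the factors can be adjoined one at a time, `A'` to `B` and `A` to
    -- the result; vanishing for `A` and `A'` separately would not combine directly.
    refine (ihA _ (ihA' ε h)).equiv (Algebra.TensorProduct.assoc k k k A A' B).symm ?_
    refine Algebra.TensorProduct.ext' fun a b => ?_
    induction b with
    | zero => simp
    | add b c hb hc => rw [TensorProduct.tmul_add, map_add, map_add, hb, hc]
    | tmul b c => simp; ring
  | equiv A A' e _ ih =>
    intro B _ _ ε h
    refine (ih ε h).equiv (Algebra.TensorProduct.congr (e : A ≃ₐ[k] A') AlgEquiv.refl) ?_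
    refine Algebra.TensorProduct.ext' fun a b => ?_
    simp

/-- The cohomology of a quantum elementary abelian group vanishes in odd degrees. -/
theorem IsQuantumElementaryAbelian.oddVanishing {A : Type u} [Ring A] [HopfAlgebra k A]
    (hA : IsQuantumElementaryAbelian k A) : OddVanishing (Bialgebra.counitAlgHom k A) := by
  refine (hA.oddVanishing_tensor (AlgHom.id k k) oddVanishing_self).equiv
    (Algebra.TensorProduct.rid k k A) ?_
  refine Algebra.TensorProduct.ext' fun a b => ?_
  simp [mul_comm]

theorem IsQuantumElementaryAbelian.mem_coboundaries {A : Type u} [Ring A] [HopfAlgebra k A]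
    (hA : IsQuantumElementaryAbelian k A) {n : ℕ} (hn : Odd n) {f : Cochain k A k n}
    (hf : f ∈ cocycles (trivialAction k A) (trivialAction k A) n) :
    f ∈ coboundaries (trivialAction k A) (trivialAction k A) n := by
  obtain ⟨i, rfl⟩ := hn
  -- The complex defining `HopfCohomology` agrees by unfolding with the bar complex of `trivialRep`
  -- at the counit.
  exact hA.oddVanishing i hf

theorem IsQuantumElementaryAbelian.hopfCohomology_eq_zero {A : Type u} [Ring A] [HopfAlgebra k A]
    (hA : IsQuantumElementaryAbelian k A) {n : ℕ} (hn : Odd n) (α : HopfCohomology k A n) :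
    α = 0 := by
  obtain ⟨f, rfl⟩ := Cohomology.mk_surjective _ _ _ α
  exact (Cohomology.mk_eq_zero _ _ _ _).2 (hA.mem_coboundaries hn f.2)

/-- The bracket of two classes of Hopf algebra cohomology is a class of Hopf algebra
cohomology. -/
theorem gerstenhaberBracket_embedding_mem_range {A : Type u} [Ring A] [HopfAlgebra k A] {p q r : ℕ}
    (hp : 0 < p) (hq : 0 < q) (h : p + q = r + 1) (α : HopfCohomology k A p)
    (β : HopfCohomology k A q) :
    gerstenhaberBracket hp hq h (embedding p α) (embedding q β) ∈
      LinearMap.range (embedding (k := k) (A := A) r) := by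
  obtain ⟨f, rfl⟩ := Cohomology.mk_surjective _ _ _ α
  obtain ⟨g, rfl⟩ := Cohomology.mk_surjective _ _ _ β
  have hmem : ∀ {n : ℕ} (f : cocycles (trivialAction k A) (trivialAction k A) n),
      embedCochain n f.1 ∈ cocycles (LinearMap.mul k A) (LinearMap.mul k A).flip n := by
    intro n f
    rw [cocycles, LinearMap.mem_ker]
    refine (embedCochain_differential n f.1).trans ?_
    rw [show differential _ _ n f.1 = 0 from f.2, map_zero]
  obtain ⟨c, hc⟩ := bracket_embedCochain_mem_range h f.1 g.1
  have hb := bracket_mem_cocycles h (hmem f) (hmem g)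
  -- Composition with $\varepsilon$ is a chain map that recovers `c` from its embedding, and the
  -- embedding of `c` is a bracket of cocycles.
  have hcc : c ∈ cocycles (trivialAction k A) (trivialAction k A) r := by
    have := counitCochain_differential r (embedCochain r c)
    rw [counitCochain_embedCochain, hc, show hochschildDifferential r _ = 0 from hb,
      map_zero] at this
    exact this
  refine ⟨Cohomology.mk _ _ r ⟨c, hcc⟩, ?_⟩
  change Cohomology.mk _ _ r ⟨embedCochain r c, hmem ⟨c, hcc⟩⟩ = Cohomology.mk _ _ r ⟨_, hb⟩
  congr 1
  ext1
  exact hc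

end OddVanishing

end QuantumElementaryAbelian

theorem theorem5p2 {k : Type u} [Field k] [CharZero k] (A : Type u) [Ring A] [HopfAlgebra k A]
    (hA : QuantumElementaryAbelian.IsQuantumElementaryAbelian k A) {p q r : ℕ}
    (hp : 0 < p) (hq : 0 < q) (h : p + q = r + 1)
    (α : QuantumElementaryAbelian.HopfCohomology k A p)
    (β : QuantumElementaryAbelian.HopfCohomology k A q) :
    QuantumElementaryAbelian.gerstenhaberBracket hp hq h
      (QuantumElementaryAbelian.embedding p α) (QuantumElementaryAbelian.embedding q β) = 0 := by
  rcases Nat.even_or_odd p with hp' | hp'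
  · rcases Nat.even_or_odd q with hq' | hq'
    · have hr : Odd r := by
        have := h ▸ hp'.add hq'
        rcases Nat.even_or_odd r with hr | hr
        · exact absurd this (Nat.not_even_iff_odd.2 hr.add_one)
        · exact hr
      -- With both degrees even neither argument need vanish, but the bracket comes from Hopf
      -- cohomology in odd degree.
      obtain ⟨γ, hγ⟩ := QuantumElementaryAbelian.gerstenhaberBracket_embedding_mem_range hp hq h α β
      rw [← hγ, hA.hopfCohomology_eq_zero hr γ, map_zero]
    · rw [hA.hopfCohomology_eq_zero hq' β, map_zero, map_zero]
  · rw [hA.hopfCohomology_eq_zero hp' α, map_zero, map_zero, LinearMap.zero_apply]
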